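/- \textbf{Theorem (Annealed SLLN for $\mathrm{GRG}_N(\boldsymbol w)$).} For every $N\ge 1$ let $\boldsymbol w=\boldsymbol w^{(N)}=(w_i)_{i\in[N]}$ be deterministic weights $w_i>0$ (which may depend on $N$), let $\ell_N=\sum_{i\in[N]}w_i$, and let $\mathrm{GRG}_N(\boldsymbol w)$ be the random simple graph on $[N]=\{1,\dots,N\}$ in which the edges $\{i,j\}$, $i<j$, are present independently with probabilities $p_{ij}=\frac{w_iw_j}{\ell_N+w_iw_j}$. Write $Q_N$ for the expectation over this graph and $E_N$ for its edge set. Let $W_N=w_{I_N}$ with $I_N$ uniform on $[N]$, and assume that there is a random variable $W$ such that, as $N\to\infty$, $$W_N\xrightarrow{\ \mathcal D\ }W,\qquad \mathbb E[W_N]=\tfrac1N\sum_{i\in[N]}w_i\to\mathbb E[W]<\infty,\qquad \mathbb E[W_N^2]=\tfrac1N\sum_{i\in[N]}w_i^2\to\mathbb E[W^2]<\infty,$$ and $\mathbb E[W]>0$. For $\beta\ge 0$ and $B\in\mathbb R$, the annealed Ising measure on $\{-1,1\}^N$ is $$\widetilde P_N(\sigma)=\frac{Q_N\big(\exp\big[\beta\sum_{(i,j)\in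 E_N}\sigma_i\sigma_j+B\sum_{i\in[N]}\sigma_i\big]\big)}{Q_N\big(\sum_{\sigma'\in\{-1,1\}^N}\exp\big[\beta\sum_{(i,j)\in E_N}\sigma'_i\sigma'_j+B\sum_{i\in[N]}\sigma'_i\big]\big)},$$ where each edge is counted once. Let $S_N=\sum_{i\in[N]}\sigma_i$, let $\widetilde M_N(\beta,B)=\widetilde P_N(S_N/N)$ be the mean of $S_N/N$ under $\widetilde P_N$, and let $\widetilde M(\beta,B)=\lim_{N\to\infty}\widetilde M_N(\beta,B)$ whenever this limit exists. Let $$\beta_c^{\mathrm{an}}=\inf\Big\{\beta>0:\ \lim_{B\to0^+}\widetilde M(\beta,B)>0\Big\},\qquad \mathcal U^{\mathrm{an}}=\big\{(\beta,B):\ \beta\ge0,\ B\ne0,\ \text{ or }\ 0<\beta<\beta_c^{\mathrm{an}},\ B=0\big\},$$ where a $\beta$ belongs to the set only if $\widetilde M(\beta,B)$ exists for all $B>0$ and has a limit as $B\to0^+$, and $\inf\emptyset=+\infty$. Then for every $(\beta,B)\in\mathcal U^{\mathrm{an}}$ the limit $\widetilde M=\widetilde M(\beta,B)$ exists, and for every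 $\varepsilon>0$ there is $L=L(\varepsilon)>0$ such that $$\widetilde P_N\left(\left|\frac{S_N}{N}-\widetilde M\right|\ge\varepsilon\right)\le e^{-NL}\qquad\text{for all sufficiently large }N .$$ -/

import Mathlib

open MeasureTheory ProbabilityTheory Filter Topology
open scoped BigOperators

namespace AnnealedIsing

noncomputable section

/-! ### The generalized random graph -/

/-- The total vertex weight `ℓ_N = ∑ i, w i`. -/
def totalWeight {N : ℕ} (w : Fin N → ℝ) : ℝ := ∑ i, w i

/-- The edge probability `p_ij = w_i w_j / (ℓ_N + w_i w_j)`, as an element of `[0, 1]`.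
The projection onto `[0, 1]` changes nothing for positive weights, see `coe_edgeProb`. -/
def edgeProb {N : ℕ} (w : Fin N → ℝ) (i j : Fin N) : unitInterval :=
  Set.projIcc 0 1 zero_le_one (w i * w j / (totalWeight w + w i * w j))

theorem coe_edgeProb {N : ℕ} {w : Fin N → ℝ} (hw : ∀ i, 0 < w i) (i j : Fin N) :
    (edgeProb w i j : ℝ) = w i * w j / (totalWeight w + w i * w j) := by
  have h1 : 0 < w i * w j := mul_pos (hw i) (hw j)
  have h2 : 0 ≤ totalWeight w := Finset.sum_nonneg fun k _ => (hw k).le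
  have h3 : w i * w j / (totalWeight w + w i * w j) ∈ Set.Icc (0 : ℝ) 1 :=
    ⟨by positivity, div_le_one_of_le₀ (by linarith) (by linarith)⟩
  simp [edgeProb, Set.projIcc_of_mem zero_le_one h3]

/-- The unordered pairs of distinct vertices, each represented by the pair `(i, j)` with `i < j`. -/
abbrev VertexPair (N : ℕ) : Type := {e : Fin N × Fin N // e.1 < e.2}

/-- The simple graph whose edges are the pairs with indicator `true`. -/
def graphOfIndicators {N : ℕ} (X : VertexPair N → Bool) : SimpleGraph (Fin N) :=
  SimpleGraph.fromRel fun i j => ∃ h : i < j, X ⟨(i, j), h⟩ = true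

/-- The law of the generalized random graph: the edge indicators are independent, and that of
`{i, j}` is Bernoulli with parameter `p_ij`. -/
def grgLaw {N : ℕ} (w : Fin N → ℝ) : Measure (SimpleGraph (Fin N)) :=
  (Measure.pi fun e : VertexPair N =>
    bernoulliMeasure true false (edgeProb w e.1.1 e.1.2)).map graphOfIndicators

/-! ### The annealed Ising measure -/

/-- Spin configurations: `ℤˣ = {1, -1}`. -/
abbrev SpinConfig (N : ℕ) : Type := Fin N → ℤˣ

/-- The spin at a vertex as a real number. -/
def spin {N : ℕ} (σ : SpinConfig N) (i : Fin N) : ℝ := ((σ i : ℤ) : ℝ)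

/-- The total spin `S_N`. -/
def totalSpin {N : ℕ} (σ : SpinConfig N) : ℝ := ∑ i, spin σ i

open Classical in
/-- The sum of `σ_i σ_j` over the edges of `G`, each edge being counted once. -/
def edgeInteraction {N : ℕ} (G : SimpleGraph (Fin N)) (σ : SpinConfig N) : ℝ :=
  ∑ i, ∑ j, if i < j ∧ G.Adj i j then spin σ i * spin σ j else 0

/-- The Boltzmann factor `exp (β ∑_{(i,j) ∈ E} σ_i σ_j + B ∑_i σ_i)` on the graph `G`. -/
def boltzmannFactor {N : ℕ} (β B : ℝ) (G : SimpleGraph (Fin N)) (σ : SpinConfig N) : ℝ :=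
  Real.exp (β * edgeInteraction G σ + B * totalSpin σ)

/-- The partition function on the graph `G`. -/
def partitionFunction {N : ℕ} (β B : ℝ) (G : SimpleGraph (Fin N)) : ℝ :=
  ∑ σ : SpinConfig N, boltzmannFactor β B G σ

/-- The annealed probability of a single spin configuration. -/
def annealedProb {N : ℕ} (w : Fin N → ℝ) (β B : ℝ) (σ : SpinConfig N) : ℝ :=
  (∫ G, boltzmannFactor β B G σ ∂grgLaw w) / ∫ G, partitionFunction β B G ∂grgLaw w

/-- The annealed measure on spin configurations. -/
def annealedMeasure {N : ℕ} (w : Fin N → ℝ) (β B : ℝ) : Measure (SpinConfig N) :=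
  ∑ σ : SpinConfig N, ENNReal.ofReal (annealedProb w β B σ) • Measure.dirac σ

/-- The finite-volume annealed magnetization: the annealed mean of `S_N / N`. -/
def annealedMagnetization {N : ℕ} (w : Fin N → ℝ) (β B : ℝ) : ℝ :=
  ∫ σ, totalSpin σ / (N : ℝ) ∂annealedMeasure w β B

/-! ### Weight regularity, critical temperature and uniqueness regime

A family of weights `w` gives a vector `w N` of `N` weights for every `N`. -/

/-- `M` is the thermodynamic limit of the annealed magnetization at `(β, B)`. -/
def IsLimitMagnetization (w : (N : ℕ) → Fin N → ℝ) (β B M : ℝ) : Prop :=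
  Tendsto (fun N : ℕ => annealedMagnetization (w N) β B) atTop (𝓝 M)

/-- `m` is the spontaneous magnetization at `β`: the limit, as `B` decreases to `0`, of the
thermodynamic limit of the magnetization. -/
def IsSpontaneousMagnetization (w : (N : ℕ) → Fin N → ℝ) (β m : ℝ) : Prop :=
  ∃ M : ℝ → ℝ, (∀ B, 0 < B → IsLimitMagnetization w β B (M B)) ∧ Tendsto M (𝓝[>] 0) (𝓝 m)

/-- The annealed critical inverse temperature: the infimum (`⊤` if there are none) of the `β > 0`
with positive spontaneous magnetization. -/
def criticalInverseTemperature (w : (N : ℕ) → Fin N → ℝ) : EReal :=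
  sInf {b : EReal | ∃ β : ℝ, b = (β : EReal) ∧ 0 < β ∧
    ∃ m : ℝ, 0 < m ∧ IsSpontaneousMagnetization w β m}

/-- The annealed uniqueness regime. -/
def uniquenessRegime (w : (N : ℕ) → Fin N → ℝ) : Set (ℝ × ℝ) :=
  {q | (0 ≤ q.1 ∧ q.2 ≠ 0) ∨ (0 < q.1 ∧ (q.1 : EReal) < criticalInverseTemperature w ∧ q.2 = 0)}

/-- Weight regularity with limiting random variable `W`: the weight `W_N` of a uniform vertex
converges to `W` in distribution, its first and second moments converge to those of `W`, these are
finite, and `E[W] > 0`. In the first field the index is shifted by one, so that the vertex set is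
not empty. -/
structure WeightRegularity (w : (N : ℕ) → Fin N → ℝ) {Ω : Type*} [MeasurableSpace Ω]
    (P : Measure Ω) [IsProbabilityMeasure P] (W : Ω → ℝ) : Prop where
  tendsto_dist : TendstoInDistribution (fun (N : ℕ) (i : Fin (N + 1)) => w (N + 1) i) atTop W
    (fun N : ℕ => uniformOn (Set.univ : Set (Fin (N + 1)))) P
  integrable : Integrable W P
  tendsto_mean : Tendsto (fun N : ℕ => (1 / (N : ℝ)) * ∑ i, w N i) atTop (𝓝 (∫ x, W x ∂P))
  integrable_sq : Integrable (fun x => W x ^ 2) P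
  tendsto_mean_sq :
    Tendsto (fun N : ℕ => (1 / (N : ℝ)) * ∑ i, w N i ^ 2) atTop (𝓝 (∫ x, W x ^ 2 ∂P))
  mean_pos : 0 < ∫ x, W x ∂P

end

end AnnealedIsing

namespace AnnealedIsing

noncomputable section

/-! ### The annealed weight as a product over vertex pairs -/

/-! Averaging over independent edges turns the annealed weight into `exp (B S_N)` times a product
over pairs of `(1 + x e^{βs}) / (1 + x)`, with `x = w_i w_j / ℓ_N` and `s = σ_i σ_j`. As `e^{βs} =
cosh β + s sinh β` and `y - y²/2 ≤ log (1 + y) ≤ y`, this is the rank-one Curie-Weiss weight with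
coupling `a = sinh β`, up to a spin-independent constant and a factor whose logarithm is `O((∑ w_i²
/ ℓ_N)²)`. Convergence of the first two moments bounds that factor, so exponential tails transfer
from Curie-Weiss (`exists_annealed_weight_bounds`, `annealedProb_le`).

For Curie-Weiss, linearizing the square at `z` leaves independent spins. Every `z` gives a lower
bound and a finite net of `z` an upper bound, so `log Z / N` tends to the pressure `p(B)`, the
maximum over `z` of the variational functional (`tendsto_log_cwPartition`). By a Chernoff bound,
`S_N / N` concentrates exponentially at `M` wherever `p'(B) = M` (`concentratesAt_of_hasDerivAt`).

It remains to differentiate `p`. For `B > 0` and `a > 0`, concavity of `tanh` makes the maximizer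
unique (`maximizer_unique`), hence continuous in `B`; when `a = 0` it plays no role. So `p` has a
continuous subgradient `D` on `B > 0`, which is its derivative there. Evenness gives `B < 0`. At `B
= 0` the right limit of `D` is the spontaneous magnetization, which vanishes below the critical
point, and then `p'(0) = 0`. -/

instance : MeasurableSingletonClass ℤˣ where
  measurableSet_singleton u :=
    ⟨{(u : ℤ)}, measurableSet_singleton _, by ext v; simp [Units.ext_iff]⟩

instance {V : Type*} [Countable V] : MeasurableSingletonClass (SimpleGraph V) where
  measurableSet_singleton G :=
    ⟨{G.Adj}, measurableSet_singleton _, by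
      ext H
      simp only [Set.mem_preimage, Set.mem_singleton_iff, SimpleGraph.adj_inj]⟩

theorem sum_vertexPair {N : ℕ} (f : Fin N → Fin N → ℝ) :
    ∑ e : VertexPair N, f e.1.1 e.1.2 = ∑ i, ∑ j, if i < j then f i j else 0 := by
  rw [← Fintype.sum_prod_type' fun i j => if i < j then f i j else 0, ← Finset.sum_filter]
  exact (Finset.sum_subtype _ (by simp) fun e : Fin N × Fin N => f e.1 e.2).symm

theorem two_mul_sum_vertexPair {N : ℕ} (f : Fin N → Fin N → ℝ) (hf : ∀ i j, f i j = f j i) :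
    2 * ∑ e : VertexPair N, f e.1.1 e.1.2 = ∑ i, ∑ j, f i j - ∑ i, f i i := by
  have h1 : ∑ i, ∑ j, f i j = ∑ i, ∑ j, (if i < j then f i j else 0)
      + ∑ i, ∑ j, (if j < i then f i j else 0) + ∑ i, ∑ j, (if i = j then f i j else 0) := by
    simp only [← Finset.sum_add_distrib]
    refine Finset.sum_congr rfl fun i _ => Finset.sum_congr rfl fun j _ => ?_
    rcases lt_trichotomy i j with h | h | h
    · simp [h, h.not_gt, h.ne]
    · simp [h]
    · simp [h, h.not_gt, h.ne']
  have h2 : ∑ i, ∑ j, (if j < i then f i j else 0) = ∑ i, ∑ j, if i < j then f i j else 0 := by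
    rw [Finset.sum_comm]
    simp only [hf]
  have h3 : ∑ i, ∑ j, (if i = j then f i j else 0) = ∑ i, f i i := by simp
  rw [sum_vertexPair, h1, h2, h3]
  ring

theorem edgeInteraction_graphOfIndicators {N : ℕ} (X : VertexPair N → Bool) (σ : SpinConfig N) :
    edgeInteraction (graphOfIndicators X) σ =
      ∑ e : VertexPair N, if X e then spin σ e.1.1 * spin σ e.1.2 else 0 := by
  classical
  have h : ∀ e : VertexPair N, X e = true ↔ ∃ h : e.1.1 < e.1.2, X ⟨(e.1.1, e.1.2), h⟩ = true :=
    fun e => ⟨fun he => ⟨e.2, he⟩, fun ⟨_, he⟩ => he⟩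
  let F : Fin N → Fin N → ℝ := fun i j =>
    if ∃ h : i < j, X ⟨(i, j), h⟩ = true then spin σ i * spin σ j else 0
  have h2 : (∑ e : VertexPair N, if X e then spin σ e.1.1 * spin σ e.1.2 else 0) =
      ∑ e : VertexPair N, F e.1.1 e.1.2 :=
    Finset.sum_congr rfl fun e _ => if_congr (h e) rfl rfl
  rw [h2, sum_vertexPair F, edgeInteraction]
  refine Finset.sum_congr rfl fun i _ => Finset.sum_congr rfl fun j _ => ?_
  by_cases hij : i < j
  · have : (graphOfIndicators X).Adj i j ↔ ∃ h : i < j, X ⟨(i, j), h⟩ = true := by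
      simp [graphOfIndicators, hij.ne, hij, hij.not_gt]
    simp [hij, this, F]
  · simp [hij]

theorem measurable_graphOfIndicators {N : ℕ} :
    Measurable (graphOfIndicators : (VertexPair N → Bool) → SimpleGraph (Fin N)) :=
  measurable_of_finite _

instance {N : ℕ} (w : Fin N → ℝ) : IsProbabilityMeasure (grgLaw w) :=
  Measure.isProbabilityMeasure_map measurable_graphOfIndicators.aemeasurable

/-- The annealed weight of a spin configuration. -/
theorem integral_boltzmannFactor {N : ℕ} (w : Fin N → ℝ) (β B : ℝ) (σ : SpinConfig N) :
    ∫ G, boltzmannFactor β B G σ ∂grgLaw w = Real.exp (B * totalSpin σ) *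
      ∏ e : VertexPair N, ((edgeProb w e.1.1 e.1.2 : ℝ)
        * Real.exp (β * (spin σ e.1.1 * spin σ e.1.2)) + (1 - (edgeProb w e.1.1 e.1.2 : ℝ))) := by
  rw [grgLaw, integral_map measurable_graphOfIndicators.aemeasurable
    (measurable_of_finite _).aestronglyMeasurable]
  let F : VertexPair N → Bool → ℝ := fun e b =>
    if b then Real.exp (β * (spin σ e.1.1 * spin σ e.1.2)) else 1
  have h : ∀ X : VertexPair N → Bool, boltzmannFactor β B (graphOfIndicators X) σ =
      Real.exp (B * totalSpin σ) * ∏ e, F e (X e) := by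
    intro X
    rw [boltzmannFactor, edgeInteraction_graphOfIndicators, Real.exp_add, mul_comm,
      Finset.mul_sum, Real.exp_sum]
    congr 1
    refine Finset.prod_congr rfl fun e _ => ?_
    cases X e <;> simp [F]
  simp_rw [h]
  rw [integral_const_mul, integral_fintype_prod_eq_prod]
  congr 1
  refine Finset.prod_congr rfl fun e _ => ?_
  rw [integral_bernoulliMeasure]
  simp [F]

theorem integral_partitionFunction {N : ℕ} (w : Fin N → ℝ) (β B : ℝ) :
    ∫ G, partitionFunction β B G ∂grgLaw w = ∑ σ, ∫ G, boltzmannFactor β B G σ ∂grgLaw w := by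
  simp only [partitionFunction]
  exact integral_finsetSum _ fun σ _ => Integrable.of_finite

theorem integral_boltzmannFactor_pos {N : ℕ} (w : Fin N → ℝ) (β B : ℝ) (σ : SpinConfig N) :
    0 < ∫ G, boltzmannFactor β B G σ ∂grgLaw w := by
  rw [integral_pos_iff_support_of_nonneg (f := fun G => boltzmannFactor β B G σ)
    (fun G => (Real.exp_pos _).le) Integrable.of_finite]
  have : Function.support (fun G => boltzmannFactor β B G σ) = Set.univ :=
    Set.eq_univ_of_forall fun G => (Real.exp_pos _).ne'
  simp [this]

theorem annealedProb_nonneg {N : ℕ} (w : Fin N → ℝ) (β B : ℝ) (σ : SpinConfig N) :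
    0 ≤ annealedProb w β B σ := by
  rw [annealedProb, integral_partitionFunction]
  exact div_nonneg (integral_boltzmannFactor_pos w β B σ).le
    (Finset.sum_nonneg fun σ _ => (integral_boltzmannFactor_pos w β B σ).le)

theorem sum_annealedProb {N : ℕ} (w : Fin N → ℝ) (β B : ℝ) :
    ∑ σ, annealedProb w β B σ = 1 := by
  simp only [annealedProb]
  rw [← Finset.sum_div, integral_partitionFunction]
  exact div_self (Finset.sum_pos (fun σ _ => integral_boltzmannFactor_pos w β B σ)
    Finset.univ_nonempty).ne'

open Classical in
theorem annealedMeasure_real {N : ℕ} (w : Fin N → ℝ) (β B : ℝ) (A : Set (SpinConfig N)) :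
    (annealedMeasure w β B).real A = ∑ σ with σ ∈ A, annealedProb w β B σ := by
  have hA : MeasurableSet A := (Set.toFinite A).measurableSet
  rw [Measure.real, annealedMeasure, Measure.finsetSum_apply, ENNReal.toReal_sum, Finset.sum_filter]
  · refine Finset.sum_congr rfl fun σ _ => ?_
    by_cases h : σ ∈ A
    · simp [h, hA, annealedProb_nonneg]
    · simp [h, hA]
  · intro σ _
    by_cases h : σ ∈ A <;> simp [h, hA]

theorem integral_annealedMeasure {N : ℕ} (w : Fin N → ℝ) (β B : ℝ) (f : SpinConfig N → ℝ) :
    ∫ σ, f σ ∂annealedMeasure w β B = ∑ σ, annealedProb w β B σ * f σ := by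
  rw [annealedMeasure, integral_finsetSum_measure fun σ _ =>
    (integrable_dirac (by simp)).smul_measure ENNReal.ofReal_ne_top]
  refine Finset.sum_congr rfl fun σ _ => ?_
  rw [integral_smul_measure, integral_dirac, ENNReal.toReal_ofReal (annealedProb_nonneg w β B σ),
    smul_eq_mul]

/-! ### Comparison with the rank-one inhomogeneous Curie-Weiss model -/

theorem spin_eq {N : ℕ} (σ : SpinConfig N) (i : Fin N) : spin σ i = 1 ∨ spin σ i = -1 := by
  rcases Int.units_eq_one_or (σ i) with h | h <;> simp [spin, h]

theorem spin_mul_self {N : ℕ} (σ : SpinConfig N) (i : Fin N) : spin σ i * spin σ i = 1 := by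
  rcases spin_eq σ i with h | h <;> simp [h]

theorem abs_spin {N : ℕ} (σ : SpinConfig N) (i : Fin N) : |spin σ i| = 1 := by
  rcases spin_eq σ i with h | h <;> simp [h]

theorem abs_totalSpin_le {N : ℕ} (σ : SpinConfig N) : |totalSpin σ| ≤ N :=
  (Finset.abs_sum_le_sum_abs _ _).trans (by simp [abs_spin])

/-- The weighted spin `∑ w_i σ_i`. -/
def weightedSpin {N : ℕ} (w : Fin N → ℝ) (σ : SpinConfig N) : ℝ := ∑ i, w i * spin σ i

/-- The unnormalized weight of the rank-one Curie-Weiss model with coupling `a`. -/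
def cwWeight {N : ℕ} (w : Fin N → ℝ) (a B : ℝ) (σ : SpinConfig N) : ℝ :=
  Real.exp (a * weightedSpin w σ ^ 2 / (2 * totalWeight w) + B * totalSpin σ)

/-- The partition function of the rank-one Curie-Weiss model. -/
def cwPartition {N : ℕ} (w : Fin N → ℝ) (a B : ℝ) : ℝ := ∑ σ : SpinConfig N, cwWeight w a B σ

theorem cwPartition_pos {N : ℕ} (w : Fin N → ℝ) (a B : ℝ) : 0 < cwPartition w a B :=
  Finset.sum_pos (fun _ _ => Real.exp_pos _) Finset.univ_nonempty

/-- Uses `2y / (y + 2) ≤ log (1 + y)` together with `(y - y²/2)(y + 2) = 2y - y³/2`. -/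
theorem exp_sub_sq_le_one_add {y : ℝ} (hy : 0 ≤ y) : Real.exp (y - y ^ 2 / 2) ≤ 1 + y := by
  rw [← Real.le_log_iff_exp_le (by linarith)]
  refine le_trans ?_ (Real.le_log_one_add_of_nonneg hy)
  rw [le_div_iff₀ (by linarith)]
  nlinarith [pow_nonneg hy 3]

theorem exp_mul_of_sq_eq_one (β : ℝ) {s : ℝ} (hs : s = 1 ∨ s = -1) :
    Real.exp (β * s) = Real.cosh β + s * Real.sinh β := by
  rcases hs with rfl | rfl
  · rw [mul_one, one_mul, Real.cosh_add_sinh]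
  · rw [mul_neg_one, neg_one_mul, ← sub_eq_add_neg, Real.cosh_sub_sinh]

/-- The full double sum is a perfect square, and its diagonal does not depend on the spins because
`σ_i² = 1`. -/
theorem sum_pair_interaction {N : ℕ} (w : Fin N → ℝ) (σ : SpinConfig N) :
    ∑ e : VertexPair N, w e.1.1 * w e.1.2 / totalWeight w * (spin σ e.1.1 * spin σ e.1.2) =
      weightedSpin w σ ^ 2 / (2 * totalWeight w) - (∑ i, w i ^ 2) / (2 * totalWeight w) := by
  have h := two_mul_sum_vertexPair
    (fun i j => w i * w j / totalWeight w * (spin σ i * spin σ j)) (fun i j => by ring)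
  have h1 : ∑ i, ∑ j, w i * w j / totalWeight w * (spin σ i * spin σ j) =
      weightedSpin w σ ^ 2 / totalWeight w := by
    rw [weightedSpin, sq, Finset.sum_mul_sum, Finset.sum_div]
    refine Finset.sum_congr rfl fun i _ => ?_
    rw [Finset.sum_div]
    exact Finset.sum_congr rfl fun j _ => by ring
  have h2 : ∑ i, w i * w i / totalWeight w * (spin σ i * spin σ i) =
      (∑ i, w i ^ 2) / totalWeight w := by
    rw [Finset.sum_div]
    exact Finset.sum_congr rfl fun i _ => by rw [spin_mul_self]; ring
  rw [h1, h2] at h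
  rw [← mul_right_inj' (two_ne_zero (α := ℝ)), h]
  ring

theorem sum_pair_sq_le {N : ℕ} (w : Fin N → ℝ) :
    ∑ e : VertexPair N, (w e.1.1 * w e.1.2 / totalWeight w) ^ 2 ≤
      ((∑ i, w i ^ 2) / totalWeight w) ^ 2 := by
  have h := two_mul_sum_vertexPair
    (fun i j => (w i * w j / totalWeight w) ^ 2) (fun i j => by ring)
  have h1 : ∑ i, ∑ j, (w i * w j / totalWeight w) ^ 2 =
      ((∑ i, w i ^ 2) / totalWeight w) ^ 2 := by
    rw [div_pow, sq (∑ i, w i ^ 2), Finset.sum_mul_sum, Finset.sum_div]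
    refine Finset.sum_congr rfl fun i _ => ?_
    rw [Finset.sum_div]
    exact Finset.sum_congr rfl fun j _ => by ring
  have h2 : 0 ≤ ∑ i, (w i * w i / totalWeight w) ^ 2 := Finset.sum_nonneg fun i _ => sq_nonneg _
  have h3 : 0 ≤ ∑ e : VertexPair N, (w e.1.1 * w e.1.2 / totalWeight w) ^ 2 :=
    Finset.sum_nonneg fun i _ => sq_nonneg _
  rw [h1] at h
  linarith

/-- Up to a factor that does not depend on the spins, the annealed weight agrees with the
Curie-Weiss weight with coupling `sinh β` within a factor controlled by `∑ w_i² / ℓ`. -/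
theorem exists_annealed_weight_bounds {N : ℕ} {w : Fin N → ℝ} (hw : ∀ i, 0 < w i)
    {β : ℝ} (hβ : 0 ≤ β) (B : ℝ) :
    ∃ K : ℝ, 0 < K ∧ ∀ σ : SpinConfig N,
      K * Real.exp (-(Real.exp (2 * β) * ((∑ i, w i ^ 2) / totalWeight w) ^ 2)) *
        cwWeight w (Real.sinh β) B σ ≤ ∫ G, boltzmannFactor β B G σ ∂grgLaw w ∧
      ∫ G, boltzmannFactor β B G σ ∂grgLaw w ≤ K * cwWeight w (Real.sinh β) B σ := by
  set l := totalWeight w with hl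
  set x : VertexPair N → ℝ := fun e => w e.1.1 * w e.1.2 / l with hx
  -- Positivity is conditional on having a pair: for `N = 0` the total weight is zero.
  have hl_pos : ∀ _ : VertexPair N, 0 < l := fun e =>
    Finset.sum_pos (fun i _ => hw i) ⟨e.1.1, Finset.mem_univ _⟩
  have hx_nonneg : ∀ e, 0 ≤ x e := fun e =>
    div_nonneg (mul_pos (hw _) (hw _)).le (hl_pos e).le
  -- `K` collects everything free of spins: the `cosh β` part of the exponent, the normalization `1
  -- + x`, and the diagonal of the square.
  let K := (∏ e, Real.exp (x e * Real.cosh β) / (1 + x e)) *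
    Real.exp (-(Real.sinh β * ((∑ i, w i ^ 2) / (2 * l))))
  have hK : 0 < K := mul_pos (Finset.prod_pos fun e _ =>
    div_pos (Real.exp_pos _) (by linarith [hx_nonneg e])) (Real.exp_pos _)
  refine ⟨K, hK, fun σ => ?_⟩
  let s : VertexPair N → ℝ := fun e => spin σ e.1.1 * spin σ e.1.2
  have hs : ∀ e, s e = 1 ∨ s e = -1 := fun e => by
    rcases spin_eq σ e.1.1 with h1 | h1 <;> rcases spin_eq σ e.1.2 with h2 | h2 <;>
      simp [s, h1, h2]
  let y : VertexPair N → ℝ := fun e => x e * Real.exp (β * s e)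
  have hy : ∀ e, 0 ≤ y e := fun e => mul_nonneg (hx_nonneg e) (Real.exp_pos _).le
  have hint : ∫ G, boltzmannFactor β B G σ ∂grgLaw w =
      Real.exp (B * totalSpin σ) * ∏ e, (1 + y e) / (1 + x e) := by
    rw [integral_boltzmannFactor]
    congr 1
    refine Finset.prod_congr rfl fun e _ => ?_
    have h1 := hl_pos e
    have h2 : 0 < w e.1.1 * w e.1.2 := mul_pos (hw _) (hw _)
    rw [coe_edgeProb hw, ← hl]
    simp only [y, x, s]
    field_simp
    ring
  -- With `exp y` in place of `1 + y` the match with Curie-Weiss is exact, since `y` is affine in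
  -- `s`.
  have hexp : (∏ e, Real.exp (y e) / (1 + x e)) * Real.exp (B * totalSpin σ) =
      K * cwWeight w (Real.sinh β) B σ := by
    have h1 : ∀ e, Real.exp (y e) / (1 + x e) =
        Real.exp (x e * Real.cosh β) / (1 + x e) * Real.exp (Real.sinh β * (x e * s e)) := by
      intro e
      have : y e = x e * Real.cosh β + Real.sinh β * (x e * s e) := by
        simp only [y, exp_mul_of_sq_eq_one β (hs e)]
        ring
      rw [this, Real.exp_add]
      ring
    simp_rw [h1]
    rw [Finset.prod_mul_distrib, ← Real.exp_sum, ← Finset.mul_sum]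
    have h2 : ∑ e, x e * s e =
        weightedSpin w σ ^ 2 / (2 * l) - (∑ i, w i ^ 2) / (2 * l) := sum_pair_interaction w σ
    simp only [K, cwWeight, h2]
    rw [mul_assoc, mul_assoc, ← Real.exp_add, ← Real.exp_add]
    congr 2
    ring
  have hsq : ∑ e, y e ^ 2 / 2 ≤ Real.exp (2 * β) * ((∑ i, w i ^ 2) / l) ^ 2 := by
    refine le_trans ?_ (mul_le_mul_of_nonneg_left (sum_pair_sq_le w) (Real.exp_pos _).le)
    rw [Finset.mul_sum]
    refine Finset.sum_le_sum fun e _ => ?_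
    have h1 : Real.exp (β * s e) ^ 2 ≤ Real.exp (2 * β) := by
      rw [← Real.exp_nat_mul]
      refine Real.exp_le_exp.2 ?_
      rcases hs e with h | h <;> rw [h] <;> push_cast <;> linarith
    have h2 : y e ^ 2 = Real.exp (β * s e) ^ 2 * x e ^ 2 := by simp only [y]; ring
    have h3 := mul_le_mul_of_nonneg_right h1 (sq_nonneg (x e))
    have h4 := sq_nonneg (y e)
    change y e ^ 2 / 2 ≤ Real.exp (2 * β) * x e ^ 2
    linarith
  constructor
  · calc K * Real.exp (-(Real.exp (2 * β) * ((∑ i, w i ^ 2) / l) ^ 2)) *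
          cwWeight w (Real.sinh β) B σ
        ≤ K * Real.exp (-∑ e, y e ^ 2 / 2) * cwWeight w (Real.sinh β) B σ := by
          have : 0 < cwWeight w (Real.sinh β) B σ := Real.exp_pos _
          gcongr
      _ = Real.exp (B * totalSpin σ) * ∏ e, Real.exp (y e - y e ^ 2 / 2) / (1 + x e) := by
          rw [mul_right_comm, ← hexp, mul_right_comm, mul_comm (Real.exp (B * totalSpin σ)),
            ← Finset.sum_neg_distrib, Real.exp_sum, ← Finset.prod_mul_distrib]
          congr 1
          refine Finset.prod_congr rfl fun e _ => ?_
          rw [sub_eq_add_neg, Real.exp_add]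
          ring
      _ ≤ _ := by
          rw [hint]
          gcongr with e he
          · intro e _
            exact div_nonneg (Real.exp_pos _).le (by linarith [hx_nonneg e])
          · linarith [hx_nonneg e]
          · exact exp_sub_sq_le_one_add (hy e)
  · rw [hint, ← hexp, mul_comm]
    gcongr with e he
    · intro e _
      exact div_nonneg (by linarith [hy e]) (by linarith [hx_nonneg e])
    · linarith [hx_nonneg e]
    · linarith [Real.add_one_le_exp (y e)]

/-- The annealed probability is dominated by the Curie-Weiss probability. -/
theorem annealedProb_le {N : ℕ} {w : Fin N → ℝ} (hw : ∀ i, 0 < w i)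
    {β : ℝ} (hβ : 0 ≤ β) (B : ℝ) (σ : SpinConfig N) :
    annealedProb w β B σ ≤
      Real.exp (Real.exp (2 * β) * ((∑ i, w i ^ 2) / totalWeight w) ^ 2) *
        (cwWeight w (Real.sinh β) B σ / cwPartition w (Real.sinh β) B) := by
  obtain ⟨K, hK, h⟩ := exists_annealed_weight_bounds hw hβ B
  set c := Real.exp (2 * β) * ((∑ i, w i ^ 2) / totalWeight w) ^ 2
  have hZ := cwPartition_pos w (Real.sinh β) B
  have h1 : K * Real.exp (-c) * cwPartition w (Real.sinh β) B ≤
      ∑ σ, ∫ G, boltzmannFactor β B G σ ∂grgLaw w := by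
    rw [cwPartition, Finset.mul_sum]
    exact Finset.sum_le_sum fun σ _ => (h σ).1
  rw [annealedProb, integral_partitionFunction]
  calc _ ≤ K * cwWeight w (Real.sinh β) B σ /
        (K * Real.exp (-c) * cwPartition w (Real.sinh β) B) :=
        div_le_div₀ (mul_pos hK (Real.exp_pos _)).le (h σ).2
          (mul_pos (mul_pos hK (Real.exp_pos _)) hZ) h1
    _ = _ := by
        rw [Real.exp_neg]
        field_simp

/-! ### Limits of weight averages -/

theorem integral_uniformOn_univ {n : ℕ} (f : Fin (n + 1) → ℝ) :
    ∫ i, f i ∂uniformOn (Set.univ : Set (Fin (n + 1))) = 1 / ((n + 1 : ℕ) : ℝ) * ∑ i, f i := by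
  rw [uniformOn, ProbabilityTheory.cond, Measure.restrict_univ, integral_smul_measure]
  have h : ((n : ENNReal) + 1).toReal = n + 1 := by
    rw [ENNReal.toReal_add (ENNReal.natCast_ne_top n) ENNReal.one_ne_top]
    simp
  simp [h]

namespace WeightRegularity

variable {w : (N : ℕ) → Fin N → ℝ} {Ω : Type*} [MeasurableSpace Ω] {P : Measure Ω}
  [IsProbabilityMeasure P] {W : Ω → ℝ}

theorem tendsto_average_of_bounded (hreg : WeightRegularity w P W) {f : ℝ → ℝ}
    (hf : Continuous f) {C : ℝ} (hC : ∀ x, |f x| ≤ C) :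
    Tendsto (fun N : ℕ => 1 / (N : ℝ) * ∑ i, f (w N i)) atTop (𝓝 (∫ x, f (W x) ∂P)) := by
  let g : BoundedContinuousFunction ℝ ℝ := BoundedContinuousFunction.ofNormedAddCommGroup f hf C hC
  have h := ProbabilityMeasure.tendsto_iff_forall_integral_tendsto.1 hreg.tendsto_dist.tendsto g
  -- Convergence in distribution is indexed by `N + 1`.
  rw [← tendsto_add_atTop_iff_nat 1]
  have h1 : ∫ x, f x ∂(P.map W) = ∫ x, f (W x) ∂P :=
    integral_map hreg.tendsto_dist.aemeasurable_limit hf.aestronglyMeasurable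
  rw [← h1]
  refine h.congr fun n => ?_
  change ∫ x, f x ∂((uniformOn Set.univ).map (w (n + 1))) = _
  rw [integral_map (measurable_of_finite _).aemeasurable hf.aestronglyMeasurable,
    integral_uniformOn_univ]

/-- A bounded continuous test function that vanishes on `[0, ∞)` and is positive on the negative
axis has zero average for every `N`, hence zero expectation at `W`. -/
theorem ae_nonneg (hreg : WeightRegularity w P W) (hw : ∀ N i, 0 < w N i) :
    ∀ᵐ x ∂P, 0 ≤ W x := by
  let f : ℝ → ℝ := fun x => min 1 (max 0 (-x))
  have hf : Continuous f := by fun_prop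
  have hf0 : ∀ x, 0 ≤ f x := fun x => le_min zero_le_one (le_max_left _ _)
  have hf1 : ∀ x, |f x| ≤ 1 := fun x => by
    rw [abs_of_nonneg (hf0 x)]
    exact min_le_left _ _
  have h := hreg.tendsto_average_of_bounded hf hf1
  have h0 : ∀ N : ℕ, 1 / (N : ℝ) * ∑ i, f (w N i) = 0 := fun N => by
    rw [Finset.sum_eq_zero fun i _ => ?_, mul_zero]
    simp [f, (hw N i).le]
  simp_rw [h0] at h
  have h1 := tendsto_nhds_unique h tendsto_const_nhds
  have hm : AEMeasurable W P := hreg.tendsto_dist.aemeasurable_limit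
  have hint : Integrable (fun x => f (W x)) P :=
    Integrable.of_bound (hf.measurable.comp_aemeasurable hm).aestronglyMeasurable 1
      (ae_of_all _ fun x => hf1 _)
  rw [integral_eq_zero_iff_of_nonneg (fun x => hf0 _) hint] at h1
  filter_upwards [h1] with x hx
  by_contra! hlt
  have : 0 < f (W x) := lt_min one_pos (lt_max_of_lt_right (neg_pos.2 hlt))
  exact this.ne' hx

theorem integrable_comp_lipschitz (hreg : WeightRegularity w P W) {f : ℝ → ℝ} {C : ℝ}
    (hf : ∀ x y, |f x - f y| ≤ C * |x - y|) : Integrable (fun x => f (W x)) P := by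
  have hf' : LipschitzWith C.toNNReal f := by
    refine LipschitzWith.of_dist_le_mul fun x y => ?_
    rw [Real.dist_eq, Real.dist_eq]
    exact (hf x y).trans (mul_le_mul_of_nonneg_right (Real.le_coe_toNNReal C) (abs_nonneg _))
  refine Integrable.mono' ((hreg.integrable.abs.const_mul C).add (integrable_const |f 0|))
    (hf'.continuous.measurable.comp_aemeasurable
      hreg.tendsto_dist.aemeasurable_limit).aestronglyMeasurable (ae_of_all _ fun x => ?_)
  have h1 := hf (W x) 0
  have h2 := abs_add_le (f (W x) - f 0) (f 0)
  rw [sub_add_cancel] at h2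
  rw [sub_zero] at h1
  simpa using h2.trans (add_le_add_left h1 _)

/-- Weak convergence handles only bounded functions, so the weights are truncated at `K`. The
truncation error is at most `C` times the lost mean; convergence of the means makes it small
uniformly in large `N` once `K` is large. -/
theorem tendsto_average_lipschitz (hreg : WeightRegularity w P W) (hw : ∀ N i, 0 < w N i)
    {f : ℝ → ℝ} {C : ℝ} (hC : 0 ≤ C) (hf : ∀ x y, |f x - f y| ≤ C * |x - y|) :
    Tendsto (fun N : ℕ => 1 / (N : ℝ) * ∑ i, f (w N i)) atTop (𝓝 (∫ x, f (W x) ∂P)) := by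
  have hf' : LipschitzWith C.toNNReal f := by
    refine LipschitzWith.of_dist_le_mul fun x y => ?_
    rw [Real.dist_eq, Real.dist_eq, Real.coe_toNNReal _ hC]
    exact hf x y
  let φ : ℕ → ℝ → ℝ := fun K x => max 0 (min x K)
  have hφ : ∀ K, Continuous (φ K) := fun K => by fun_prop
  have hφ0 : ∀ K x, 0 ≤ φ K x := fun K x => le_max_left _ _
  have hφK : ∀ K x, φ K x ≤ K := fun K x => max_le (by positivity) (min_le_right _ _)
  have hφx : ∀ K x, 0 ≤ x → φ K x ≤ x := fun K x hx => max_le hx (min_le_left _ _)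
  have hm : AEMeasurable W P := hreg.tendsto_dist.aemeasurable_limit
  have hW := hreg.ae_nonneg hw
  have hφint : ∀ K, Integrable (fun x => φ K (W x)) P := fun K =>
    Integrable.of_bound ((hφ K).measurable.comp_aemeasurable hm).aestronglyMeasurable K
      (ae_of_all _ fun x => by rw [Real.norm_eq_abs, abs_of_nonneg (hφ0 _ _)]; exact hφK _ _)
  have hlim : Tendsto (fun K : ℕ => ∫ x, φ K (W x) ∂P) atTop (𝓝 (∫ x, W x ∂P)) := by
    refine tendsto_integral_of_dominated_convergence W (fun K => (hφint K).1) hreg.integrable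
      (fun K => ?_) ?_
    · filter_upwards [hW] with x hx
      rw [Real.norm_eq_abs, abs_of_nonneg (hφ0 _ _)]
      exact hφx _ _ hx
    · filter_upwards [hW] with x hx
      refine tendsto_const_nhds.congr' ?_
      filter_upwards [eventually_ge_atTop ⌈W x⌉₊] with K hK
      simp only [φ]
      rw [min_eq_left ((Nat.le_ceil _).trans (Nat.cast_le.2 hK)), max_eq_right hx]
  have hcomp : ∀ K x, 0 ≤ x → |f x - f (φ K x)| ≤ C * (x - φ K x) := fun K x hx => by
    have := hf x (φ K x)
    rwa [abs_of_nonneg (sub_nonneg.2 (hφx K x hx))] at this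
  have hbd : ∀ K x, |f (φ K x)| ≤ |f 0| + C * K := fun K x => by
    have h1 := hf (φ K x) 0
    have h2 := abs_add_le (f (φ K x) - f 0) (f 0)
    rw [sub_add_cancel] at h2
    rw [sub_zero, abs_of_nonneg (hφ0 _ _)] at h1
    have h3 := mul_le_mul_of_nonneg_left (hφK K x) hC
    linarith
  refine Metric.tendsto_nhds.2 fun ε hε => ?_
  obtain ⟨K, hK⟩ : ∃ K : ℕ, C * (∫ x, W x ∂P - ∫ x, φ K (W x) ∂P) < ε / 4 := by
    have : Tendsto (fun K : ℕ => C * (∫ x, W x ∂P - ∫ x, φ K (W x) ∂P)) atTop (𝓝 0) := by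
      simpa using (hlim.const_sub (∫ x, W x ∂P)).const_mul C
    exact (this.eventually (gt_mem_nhds (by positivity))).exists
  have h1 := hreg.tendsto_average_of_bounded (hf'.continuous.comp (hφ K)) (hbd K)
  have h2 := hreg.tendsto_average_of_bounded (hφ K) (C := K) fun x => by
    rw [abs_of_nonneg (hφ0 _ _)]; exact hφK _ _
  have h3 := (hreg.tendsto_mean.sub h2).const_mul C
  have hfφ : Integrable (fun x => f (φ K (W x))) P :=
    Integrable.of_bound ((hf'.continuous.comp (hφ K)).measurable.comp_aemeasurable
      hm).aestronglyMeasurable (|f 0| + C * K) (ae_of_all _ fun x => hbd K _)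
  have h4 : |∫ x, f (W x) ∂P - ∫ x, f (φ K (W x)) ∂P| ≤
      C * (∫ x, W x ∂P - ∫ x, φ K (W x) ∂P) := by
    rw [← integral_sub (hreg.integrable_comp_lipschitz hf) hfφ,
      ← integral_sub hreg.integrable (hφint K), ← integral_const_mul]
    refine norm_integral_le_of_norm_le (f := fun x => f (W x) - f (φ K (W x)))
      ((hreg.integrable.sub (hφint K)).const_mul C) ?_
    filter_upwards [hW] with x hx using hcomp K _ hx
  have h6 := h3.eventually (gt_mem_nhds hK)
  filter_upwards [h1.eventually (Metric.ball_mem_nhds _ (by positivity : 0 < ε / 4)), h6]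
    with N hN1 hN2
  have h7 : |1 / (N : ℝ) * ∑ i, f (w N i) - 1 / (N : ℝ) * ∑ i, f (φ K (w N i))| ≤
      C * (1 / (N : ℝ) * ∑ i, w N i - 1 / (N : ℝ) * ∑ i, φ K (w N i)) := by
    rw [← mul_sub, ← mul_sub, ← Finset.sum_sub_distrib, ← Finset.sum_sub_distrib, abs_mul,
      abs_of_nonneg (by positivity : 0 ≤ 1 / (N : ℝ)), mul_left_comm, Finset.mul_sum _ _ C]
    refine mul_le_mul_of_nonneg_left ?_ (by positivity)
    exact (Finset.abs_sum_le_sum_abs _ _).trans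
      (Finset.sum_le_sum fun i _ => hcomp K _ (hw N i).le)
  rw [Real.dist_eq]
  have h8 : |1 / (N : ℝ) * ∑ i, f (φ K (w N i)) - ∫ x, f (φ K (W x)) ∂P| < ε / 4 := hN1
  rw [abs_sub_comm] at h4
  have h9 := abs_sub_le (1 / (N : ℝ) * ∑ i, f (w N i)) (1 / (N : ℝ) * ∑ i, f (φ K (w N i)))
    (∫ x, f (W x) ∂P)
  have h10 := abs_sub_le (1 / (N : ℝ) * ∑ i, f (φ K (w N i))) (∫ x, f (φ K (W x)) ∂P)
    (∫ x, f (W x) ∂P)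
  linarith

end WeightRegularity

/-! ### The function `log (2 cosh x)` -/

/-- The log-partition function `log (e^x + e^{-x})` of a single spin in the field `x`. -/
def logTwoCosh (x : ℝ) : ℝ := Real.log (2 * Real.cosh x)

theorem exp_logTwoCosh (x : ℝ) : Real.exp (logTwoCosh x) = Real.exp x + Real.exp (-x) := by
  rw [logTwoCosh, Real.exp_log (by have := Real.cosh_pos x; positivity), Real.cosh_eq]
  ring

theorem logTwoCosh_neg (x : ℝ) : logTwoCosh (-x) = logTwoCosh x := by simp [logTwoCosh]

theorem logTwoCosh_lt_of_abs_lt {x y : ℝ} (h : |x| < |y|) : logTwoCosh x < logTwoCosh y := by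
  have := Real.cosh_pos x
  exact Real.log_lt_log (by positivity) (by linarith [Real.cosh_lt_cosh.2 h])

theorem hasDerivAt_logTwoCosh (x : ℝ) : HasDerivAt logTwoCosh (Real.tanh x) x := by
  have h := ((Real.hasDerivAt_cosh x).const_mul 2).log
    (mul_pos two_pos (Real.cosh_pos x)).ne'
  rwa [mul_div_mul_left _ _ two_ne_zero, ← Real.tanh_eq_sinh_div_cosh] at h

theorem hasDerivAt_tanh (x : ℝ) : HasDerivAt Real.tanh (1 / Real.cosh x ^ 2) x := by
  have hc := (Real.cosh_pos x).ne'
  have h := (Real.hasDerivAt_sinh x).div (Real.hasDerivAt_cosh x) hc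
  have h1 : (Real.cosh x * Real.cosh x - Real.sinh x * Real.sinh x) = 1 := by
    linarith [Real.cosh_sq_sub_sinh_sq x]
  rw [h1] at h
  exact h.congr_of_eventuallyEq (.of_forall fun y => Real.tanh_eq_sinh_div_cosh y)

theorem continuous_tanh : Continuous Real.tanh :=
  continuous_iff_continuousAt.2 fun x => (hasDerivAt_tanh x).continuousAt

theorem monotone_tanh : Monotone Real.tanh :=
  monotone_of_deriv_nonneg (fun x => (hasDerivAt_tanh x).differentiableAt) fun x => by
    rw [(hasDerivAt_tanh x).deriv]
    positivity

theorem tanh_pos {x : ℝ} (hx : 0 < x) : 0 < Real.tanh x := by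
  rw [Real.tanh_eq_sinh_div_cosh]
  exact div_pos (Real.sinh_pos_iff.2 hx) (Real.cosh_pos x)

theorem abs_sub_le_of_abs_deriv_le_one {f f' : ℝ → ℝ} (hf : ∀ x, HasDerivAt f (f' x) x)
    (hf' : ∀ x, |f' x| ≤ 1) (x y : ℝ) : |f x - f y| ≤ |x - y| := by
  simpa using convex_univ.norm_image_sub_le_of_norm_hasDerivWithin_le (C := 1)
    (fun z _ => (hf z).hasDerivWithinAt) (fun z _ => hf' z) (Set.mem_univ y) (Set.mem_univ x)

theorem abs_logTwoCosh_sub_le (x y : ℝ) : |logTwoCosh x - logTwoCosh y| ≤ |x - y| :=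
  abs_sub_le_of_abs_deriv_le_one hasDerivAt_logTwoCosh (fun x => (Real.abs_tanh_lt_one x).le) x y

theorem abs_tanh_sub_le (x y : ℝ) : |Real.tanh x - Real.tanh y| ≤ |x - y| :=
  abs_sub_le_of_abs_deriv_le_one hasDerivAt_tanh (fun x => by
    rw [abs_of_nonneg (by positivity), div_le_one (by have := Real.cosh_pos x; positivity)]
    exact one_le_pow₀ (Real.one_le_cosh x)) x y

theorem logTwoCosh_add_tanh_mul_le (x y : ℝ) :
    logTwoCosh x + Real.tanh x * (y - x) ≤ logTwoCosh y := by
  have hconv : ConvexOn ℝ Set.univ logTwoCosh := by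
    refine Monotone.convexOn_univ_of_deriv
      (fun x => (hasDerivAt_logTwoCosh x).differentiableAt) ?_
    rw [funext fun x => (hasDerivAt_logTwoCosh x).deriv]
    exact monotone_tanh
  rcases lt_trichotomy x y with h | rfl | h
  · have h1 := hconv.le_slope_of_hasDerivAt (Set.mem_univ x) (Set.mem_univ y) h
      (hasDerivAt_logTwoCosh x)
    rw [slope_def_field, le_div_iff₀ (sub_pos.2 h)] at h1
    linarith
  · simp
  · have h1 := hconv.slope_le_of_hasDerivAt (Set.mem_univ y) (Set.mem_univ x) h
      (hasDerivAt_logTwoCosh x)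
    rw [slope_def_field, div_le_iff₀ (sub_pos.2 h)] at h1
    linarith

theorem concaveOn_tanh : ConcaveOn ℝ (Set.Ici 0) Real.tanh := by
  refine AntitoneOn.concaveOn_of_deriv (convex_Ici 0) continuous_tanh.continuousOn
    (fun x _ => (hasDerivAt_tanh x).differentiableAt.differentiableWithinAt) ?_
  intro x hx y hy hxy
  rw [interior_Ici] at hx hy
  rw [(hasDerivAt_tanh x).deriv, (hasDerivAt_tanh y).deriv]
  have h1 := Real.cosh_pos x
  have h2 : Real.cosh x ≤ Real.cosh y :=
    Real.cosh_le_cosh.2 (by rwa [abs_of_pos hx, abs_of_pos hy])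
  gcongr

/-- The point `ux + B` is a convex combination of `B` and `vx + B`. Concavity of `tanh` gives the
inequality, and `tanh B > 0` makes it strict, even at `x = 0`. -/
theorem mul_tanh_affine_lt {u v x B : ℝ} (hu : 0 < u) (huv : u < v) (hx : 0 ≤ x) (hB : 0 < B) :
    u * Real.tanh (v * x + B) < v * Real.tanh (u * x + B) := by
  have hv : 0 < v := hu.trans huv
  have h := concaveOn_tanh.2 (show B ∈ Set.Ici 0 from hB.le)
    (show v * x + B ∈ Set.Ici 0 from (by positivity : 0 ≤ v * x + B))
    (sub_nonneg.2 ((div_le_one hv).2 huv.le)) (div_pos hu hv).le (sub_add_cancel 1 (u / v))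
  simp only [smul_eq_mul] at h
  have h1 : (1 - u / v) * B + u / v * (v * x + B) = u * x + B := by field_simp; ring
  have h2 : 0 < (1 - u / v) * Real.tanh B :=
    mul_pos (sub_pos.2 ((div_lt_one hv).2 huv)) (tanh_pos hB)
  rw [h1] at h
  have h3 : u / v * Real.tanh (v * x + B) < Real.tanh (u * x + B) := by linarith
  rw [div_mul_eq_mul_div, div_lt_iff₀ hv] at h3
  linarith

/-! ### The pressure of the Curie-Weiss model -/

theorem sum_exp_field {N : ℕ} (h : Fin N → ℝ) :
    ∑ σ : SpinConfig N, Real.exp (∑ i, h i * spin σ i) = Real.exp (∑ i, logTwoCosh (h i)) := by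
  rw [Real.exp_sum]
  have h1 : ∀ i, Real.exp (logTwoCosh (h i)) = ∑ u : ℤˣ, Real.exp (h i * ((u : ℤ) : ℝ)) := by
    intro i
    rw [exp_logTwoCosh]
    simp [UnitsInt.univ]
  simp_rw [h1]
  rw [Finset.prod_univ_sum, Fintype.piFinset_univ]
  refine Finset.sum_congr rfl fun σ _ => ?_
  rw [Real.exp_sum]
  rfl

/-- The finite-volume variational functional, multiplied by the number of vertices. -/
def finiteVariational {N : ℕ} (w : Fin N → ℝ) (a z B : ℝ) : ℝ :=
  -(a * totalWeight w * z ^ 2 / 2) + ∑ i, logTwoCosh (a * z * w i + B)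

theorem sum_exp_linearized {N : ℕ} (w : Fin N → ℝ) (a z B : ℝ) :
    ∑ σ : SpinConfig N, Real.exp (-(a * totalWeight w * z ^ 2 / 2) +
      (a * z * weightedSpin w σ + B * totalSpin σ)) = Real.exp (finiteVariational w a z B) := by
  rw [finiteVariational, Real.exp_add, ← sum_exp_field, Finset.mul_sum]
  refine Finset.sum_congr rfl fun σ _ => ?_
  rw [Real.exp_add]
  congr 2
  rw [weightedSpin, totalSpin, Finset.mul_sum, Finset.mul_sum, ← Finset.sum_add_distrib]
  exact Finset.sum_congr rfl fun i _ => by ring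

/-- The quadratic energy exceeds its linearization at `z` by a perfect square, configuration by
configuration. -/
theorem exp_finiteVariational_le {N : ℕ} {w : Fin N → ℝ} (hl : 0 < totalWeight w) {a : ℝ}
    (ha : 0 ≤ a) (z B : ℝ) : Real.exp (finiteVariational w a z B) ≤ cwPartition w a B := by
  rw [← sum_exp_linearized]
  refine Finset.sum_le_sum fun σ _ => Real.exp_le_exp.2 ?_
  have h : a * weightedSpin w σ ^ 2 / (2 * totalWeight w) -
      (-(a * totalWeight w * z ^ 2 / 2) + a * z * weightedSpin w σ) =
      a * (weightedSpin w σ - totalWeight w * z) ^ 2 / (2 * totalWeight w) := by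
    field_simp
    ring
  have h2 : 0 ≤ a * (weightedSpin w σ - totalWeight w * z) ^ 2 / (2 * totalWeight w) := by
    positivity
  linarith

theorem abs_weightedSpin_le {N : ℕ} {w : Fin N → ℝ} (hw : ∀ i, 0 < w i) (σ : SpinConfig N) :
    |weightedSpin w σ| ≤ totalWeight w :=
  (Finset.abs_sum_le_sum_abs _ _).trans
    (Finset.sum_le_sum fun i _ => by rw [abs_mul, abs_spin, mul_one, abs_of_pos (hw i)])

/-- Each configuration has weighted spin over total weight in `[-1, 1]`; linearizing at a net point
within `η` of it costs at most `a ℓ η² / 2`. -/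
theorem cwPartition_le_sum {N : ℕ} {w : Fin N → ℝ} (hw : ∀ i, 0 < w i)
    (hl : 0 < totalWeight w) {a : ℝ} (ha : 0 ≤ a) (B : ℝ) {T : Finset ℝ} {η : ℝ}
    (hT : ∀ y ∈ Set.Icc (-1 : ℝ) 1, ∃ z ∈ T, |y - z| ≤ η) :
    cwPartition w a B ≤ ∑ z ∈ T, Real.exp (a * totalWeight w * η ^ 2 / 2) *
      Real.exp (finiteVariational w a z B) := by
  simp_rw [← sum_exp_linearized, Finset.mul_sum, ← Real.exp_add]
  rw [Finset.sum_comm]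
  refine Finset.sum_le_sum fun σ _ => ?_
  obtain ⟨z, hz, hyz⟩ := hT (weightedSpin w σ / totalWeight w) (by
    rw [Set.mem_Icc, ← abs_le, abs_div, abs_of_pos hl]
    exact (div_le_one hl).2 (abs_weightedSpin_le hw σ))
  refine le_trans (Real.exp_le_exp.2 ?_) (Finset.single_le_sum (f := fun z =>
    Real.exp (a * totalWeight w * η ^ 2 / 2 + (-(a * totalWeight w * z ^ 2 / 2) +
      (a * z * weightedSpin w σ + B * totalSpin σ)))) (fun z _ => (Real.exp_pos _).le) hz)
  have h : a * weightedSpin w σ ^ 2 / (2 * totalWeight w) -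
      (-(a * totalWeight w * z ^ 2 / 2) + a * z * weightedSpin w σ) =
      a * totalWeight w / 2 * (weightedSpin w σ / totalWeight w - z) ^ 2 := by
    field_simp
    ring
  have h2 : (weightedSpin w σ / totalWeight w - z) ^ 2 ≤ η ^ 2 := by
    rw [← sq_abs]
    exact pow_le_pow_left₀ (abs_nonneg _) hyz 2
  have h3 := mul_le_mul_of_nonneg_left h2 (by positivity : 0 ≤ a * totalWeight w / 2)
  linarith

/-- The limiting variational functional. -/
def variational {Ω : Type*} [MeasurableSpace Ω] (P : Measure Ω) (W : Ω → ℝ) (a z B : ℝ) : ℝ :=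
  -(a * (∫ x, W x ∂P) * z ^ 2 / 2) + ∫ x, logTwoCosh (a * z * W x + B) ∂P

/-- The limiting pressure. -/
def pressure {Ω : Type*} [MeasurableSpace Ω] (P : Measure Ω) (W : Ω → ℝ) (a B : ℝ) : ℝ :=
  sSup ((fun z => variational P W a z B) '' Set.Icc (-1) 1)

/-! ### Convergence of the finite-volume pressure. -/

namespace WeightRegularity

variable {w : (N : ℕ) → Fin N → ℝ} {Ω : Type*} [MeasurableSpace Ω] {P : Measure Ω}
  [IsProbabilityMeasure P] {W : Ω → ℝ}

theorem integrable_affine (hreg : WeightRegularity w P W) {g : ℝ → ℝ}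
    (hg : ∀ x y, |g x - g y| ≤ |x - y|) (u B : ℝ) : Integrable (fun x => g (u * W x + B)) P :=
  hreg.integrable_comp_lipschitz (f := fun x => g (u * x + B)) (C := |u|) fun x y =>
    (hg _ _).trans_eq (by rw [← abs_mul]; congr 1; ring)

theorem abs_integral_affine_sub_le (hreg : WeightRegularity w P W) (hw : ∀ N i, 0 < w N i)
    {g : ℝ → ℝ} (hg : ∀ x y, |g x - g y| ≤ |x - y|) (u v B B' : ℝ) :
    |∫ x, g (u * W x + B) ∂P - ∫ x, g (v * W x + B') ∂P| ≤
      |u - v| * (∫ x, W x ∂P) + |B - B'| := by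
  rw [← integral_sub (hreg.integrable_affine hg u B) (hreg.integrable_affine hg v B')]
  have h : ∫ x, (|u - v| * W x + |B - B'|) ∂P = |u - v| * (∫ x, W x ∂P) + |B - B'| := by
    rw [integral_add (hreg.integrable.const_mul _) (integrable_const _), integral_const_mul]
    simp
  rw [← h]
  refine norm_integral_le_of_norm_le (f := fun x => g (u * W x + B) - g (v * W x + B'))
    ((hreg.integrable.const_mul _).add (integrable_const _)) ?_
  filter_upwards [hreg.ae_nonneg hw] with x hx
  refine (hg _ _).trans ?_
  calc |u * W x + B - (v * W x + B')| = |(u - v) * W x + (B - B')| := by congr 1; ring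
    _ ≤ |u - v| * W x + |B - B'| := by
      refine (abs_add_le _ _).trans ?_
      rw [abs_mul, abs_of_nonneg hx]

theorem continuous_variational (hreg : WeightRegularity w P W) (hw : ∀ N i, 0 < w N i)
    (a B : ℝ) : Continuous fun z => variational P W a z B := by
  refine Continuous.add (by fun_prop) (LipschitzWith.continuous
    (K := (|a| * ∫ x, W x ∂P).toNNReal) (LipschitzWith.of_dist_le_mul fun z z' => ?_))
  rw [Real.coe_toNNReal _ (mul_nonneg (abs_nonneg _) hreg.mean_pos.le), Real.dist_eq, Real.dist_eq]
  refine (hreg.abs_integral_affine_sub_le hw abs_logTwoCosh_sub_le _ _ B B).trans_eq ?_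
  rw [sub_self, abs_zero, add_zero, ← mul_sub, abs_mul]
  ring

theorem exists_variational_eq_pressure (hreg : WeightRegularity w P W)
    (hw : ∀ N i, 0 < w N i) (a B : ℝ) :
    ∃ z ∈ Set.Icc (-1 : ℝ) 1, variational P W a z B = pressure P W a B := by
  obtain ⟨z, hz, h⟩ := isCompact_Icc.exists_sSup_image_eq
    (Set.nonempty_Icc.2 (by norm_num : (-1 : ℝ) ≤ 1))
    (hreg.continuous_variational hw a B).continuousOn
  exact ⟨z, hz, h.symm⟩

theorem variational_le_pressure_of_mem_Icc (hreg : WeightRegularity w P W)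
    (hw : ∀ N i, 0 < w N i) (a B : ℝ) {z : ℝ} (hz : z ∈ Set.Icc (-1 : ℝ) 1) :
    variational P W a z B ≤ pressure P W a B :=
  le_csSup (isCompact_Icc.image (hreg.continuous_variational hw a B)).bddAbove
    (Set.mem_image_of_mem _ hz)

theorem eventually_totalWeight_pos (hw : ∀ N i, 0 < w N i) :
    ∀ᶠ N : ℕ in atTop, 0 < totalWeight (w N) := by
  filter_upwards [eventually_gt_atTop 0] with N hN
  exact Finset.sum_pos (fun i _ => hw N i) ⟨⟨0, hN⟩, Finset.mem_univ _⟩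

theorem tendsto_finiteVariational (hreg : WeightRegularity w P W) (hw : ∀ N i, 0 < w N i)
    (a z B : ℝ) :
    Tendsto (fun N : ℕ => finiteVariational (w N) a z B / N) atTop
      (𝓝 (variational P W a z B)) := by
  have h1 := hreg.tendsto_average_lipschitz hw (abs_nonneg (a * z))
    (f := fun x => logTwoCosh (a * z * x + B)) fun x y =>
      (abs_logTwoCosh_sub_le _ _).trans_eq (by rw [← abs_mul]; congr 1; ring)
  have h2 := (hreg.tendsto_mean.const_mul (-(a * z ^ 2 / 2))).add h1
  have h3 : -(a * z ^ 2 / 2) * (∫ x, W x ∂P) + ∫ x, logTwoCosh (a * z * W x + B) ∂P =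
      variational P W a z B := by
    rw [variational]
    ring
  rw [h3] at h2
  refine h2.congr fun N => ?_
  rw [finiteVariational, totalWeight]
  ring

theorem eventually_lt_log_cwPartition (hreg : WeightRegularity w P W) (hw : ∀ N i, 0 < w N i)
    {a : ℝ} (ha : 0 ≤ a) {z B c : ℝ} (hc : c < variational P W a z B) :
    ∀ᶠ N : ℕ in atTop, c < Real.log (cwPartition (w N) a B) / N := by
  filter_upwards [(hreg.tendsto_finiteVariational hw a z B).eventually (lt_mem_nhds hc),
    eventually_totalWeight_pos hw] with N h1 h2
  refine h1.trans_le (div_le_div_of_nonneg_right ?_ (Nat.cast_nonneg N))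
  rw [Real.le_log_iff_exp_le (cwPartition_pos _ _ _)]
  exact exp_finiteVariational_le h2 ha z B

theorem eventually_log_cwPartition_lt (hreg : WeightRegularity w P W) (hw : ∀ N i, 0 < w N i)
    {a : ℝ} (ha : 0 ≤ a) {B c : ℝ} (hc : pressure P W a B < c) :
    ∀ᶠ N : ℕ in atTop, Real.log (cwPartition (w N) a B) / N < c := by
  set p := pressure P W a B with hp
  set m := ∫ x, W x ∂P with hm_def
  -- The gap `c - p` pays one quarter each for the mesh, the size of the net and the convergence at
  -- the net points.
  obtain ⟨η, hη, hηδ⟩ : ∃ η : ℝ, 0 < η ∧ a * m * η ^ 2 / 2 < (c - p) / 4 := by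
    have h : Tendsto (fun η : ℝ => a * m * η ^ 2 / 2) (𝓝[>] 0) (𝓝 0) :=
      (Continuous.tendsto' (by fun_prop) 0 0 (by simp)).mono_left nhdsWithin_le_nhds
    obtain ⟨η, h1, h2⟩ := ((h.eventually (gt_mem_nhds (by linarith : 0 < (c - p) / 4))).and
      self_mem_nhdsWithin).exists
    exact ⟨η, h2, h1⟩
  obtain ⟨t, htI, htf, ht⟩ := (isCompact_Icc (a := (-1 : ℝ)) (b := 1)).finite_cover_balls hη
  lift t to Finset ℝ using htf
  have hT : ∀ y ∈ Set.Icc (-1 : ℝ) 1, ∃ z ∈ t, |y - z| ≤ η := fun y hy => by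
    obtain ⟨z, hz, h⟩ := Set.mem_iUnion₂.1 (ht hy)
    exact ⟨z, hz, (Metric.mem_ball.1 h).le⟩
  have htne : t.Nonempty := by
    obtain ⟨z, hz, -⟩ := hT 0 (by simp)
    exact ⟨z, hz⟩
  have hcard : (0 : ℝ) < t.card := Nat.cast_pos.2 htne.card_pos
  have h1 : ∀ᶠ N : ℕ in atTop, ∀ z ∈ t, finiteVariational (w N) a z B / N < p + (c - p) / 4 := by
    rw [Filter.eventually_all_finset]
    intro z hz
    refine (hreg.tendsto_finiteVariational hw a z B).eventually (gt_mem_nhds ?_)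
    linarith [hreg.variational_le_pressure_of_mem_Icc hw a B (htI hz)]
  have h2 : Tendsto (fun N : ℕ => Real.log t.card / N) atTop (𝓝 0) :=
    tendsto_const_div_atTop_nhds_zero_nat _
  have h3 : Tendsto (fun N : ℕ => a * totalWeight (w N) * η ^ 2 / 2 / N) atTop
      (𝓝 (a * m * η ^ 2 / 2)) := by
    have h := hreg.tendsto_mean.const_mul (a * η ^ 2 / 2)
    rw [← hm_def, show a * η ^ 2 / 2 * m = a * m * η ^ 2 / 2 by ring] at h
    refine h.congr fun N => ?_
    rw [totalWeight]
    ring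
  filter_upwards [h1, h2.eventually (gt_mem_nhds (by linarith : 0 < (c - p) / 4)),
    h3.eventually (gt_mem_nhds hηδ), eventually_totalWeight_pos hw, eventually_gt_atTop 0]
    with N h4 h5 h6 h7 h8
  have hN : (0 : ℝ) < N := Nat.cast_pos.2 h8
  have h9 : cwPartition (w N) a B ≤ t.card * Real.exp (a * totalWeight (w N) * η ^ 2 / 2 +
      N * (p + (c - p) / 4)) := by
    refine (cwPartition_le_sum (hw N) h7 ha B hT).trans ?_
    rw [← nsmul_eq_mul]
    refine Finset.sum_le_card_nsmul _ _ _ fun z hz => ?_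
    rw [← Real.exp_add]
    refine Real.exp_le_exp.2 (add_le_add_right ?_ _)
    have := (div_lt_iff₀ hN).1 (h4 z hz)
    linarith
  have h10 := Real.log_le_log (cwPartition_pos _ _ _) h9
  rw [Real.log_mul hcard.ne' (Real.exp_pos _).ne', Real.log_exp] at h10
  rw [div_lt_iff₀ hN] at h5 h6 ⊢
  nlinarith

/-- The lower bound on `log Z / N` holds at every real `z`, the upper bound needs only `[-1, 1]`.
Maximizers are therefore global and stationary, even at the endpoints. -/
theorem variational_le_pressure (hreg : WeightRegularity w P W) (hw : ∀ N i, 0 < w N i)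
    {a : ℝ} (ha : 0 ≤ a) (z B : ℝ) : variational P W a z B ≤ pressure P W a B := by
  by_contra! h
  obtain ⟨c, h1, h2⟩ := exists_between h
  obtain ⟨N, h3, h4⟩ := ((hreg.eventually_log_cwPartition_lt hw ha h1).and
    (hreg.eventually_lt_log_cwPartition hw ha h2)).exists
  exact h3.not_gt h4

theorem tendsto_log_cwPartition (hreg : WeightRegularity w P W) (hw : ∀ N i, 0 < w N i)
    {a : ℝ} (ha : 0 ≤ a) (B : ℝ) :
    Tendsto (fun N : ℕ => Real.log (cwPartition (w N) a B) / N) atTop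
      (𝓝 (pressure P W a B)) := by
  obtain ⟨z, -, hz⟩ := hreg.exists_variational_eq_pressure hw a B
  exact tendsto_order.2 ⟨fun c hc => hreg.eventually_lt_log_cwPartition hw ha (hz.symm ▸ hc),
    fun c hc => hreg.eventually_log_cwPartition_lt hw ha hc⟩

end WeightRegularity

/-! ### Differentiability of the pressure -/

/-- The increment `p y - p x` lies between `D x * (y - x)` and `D y * (y - x)`. -/
theorem hasDerivAt_of_subgradient {p D : ℝ → ℝ} (h : ∀ x y, p x + D x * (y - x) ≤ p y) {x : ℝ}
    (hD : ContinuousAt D x) : HasDerivAt p (D x) x := by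
  rw [hasDerivAt_iff_isLittleO, Asymptotics.isLittleO_iff]
  intro c hc
  filter_upwards [hD.eventually (Metric.ball_mem_nhds _ hc)] with y hy
  have h1 := h x y
  have h2 := h y x
  have h3 : |D y - D x| < c := hy
  have h4 : (D y - D x) * (y - x) ≤ c * |y - x| :=
    (le_abs_self _).trans (by rw [abs_mul]; gcongr)
  rw [Real.norm_eq_abs, Real.norm_eq_abs, smul_eq_mul, abs_of_nonneg (by linarith)]
  linarith

theorem monotone_of_subgradient {p D : ℝ → ℝ} (h : ∀ x y, p x + D x * (y - x) ≤ p y) :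
    Monotone D := by
  intro x y hxy
  rcases hxy.eq_or_lt with rfl | hlt
  · exact le_rfl
  · have h1 := h x y
    have h2 := h y x
    by_contra! h3
    nlinarith [mul_pos (sub_pos.2 h3) (sub_pos.2 hlt)]

/-- Evenness makes `0` a minimum and reduces to `|y|`, where `0 ≤ p |y| - p 0 ≤ D |y| * |y|`. The
value `D 0` plays no role. -/
theorem hasDerivAt_zero_of_subgradient_tendsto {p D : ℝ → ℝ}
    (h : ∀ x y, p x + D x * (y - x) ≤ p y) (heven : ∀ x, p (-x) = p x)
    (hD : Tendsto D (𝓝[>] 0) (𝓝 0)) : HasDerivAt p 0 0 := by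
  have hmin : ∀ x, p 0 ≤ p x := fun x => by
    have h1 := h 0 x
    have h2 := h 0 (-x)
    rw [heven] at h2
    linarith
  rw [hasDerivAt_iff_isLittleO, Asymptotics.isLittleO_iff]
  intro c hc
  have h1 : ∀ᶠ x : ℝ in 𝓝[>] 0, D x < c := hD.eventually (gt_mem_nhds hc)
  obtain ⟨δ, hδ, h2⟩ := mem_nhdsGT_iff_exists_Ioo_subset.1 h1
  filter_upwards [Metric.ball_mem_nhds 0 hδ] with y hy
  rw [Metric.mem_ball, dist_zero_right, Real.norm_eq_abs] at hy
  simp only [sub_zero, smul_zero, Real.norm_eq_abs]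
  rw [abs_of_nonneg (sub_nonneg.2 (hmin y))]
  rcases eq_or_ne y 0 with rfl | hy0
  · simp
  have h3 : D |y| < c := h2 ⟨abs_pos.2 hy0, hy⟩
  have h4 := h |y| 0
  have h5 : p |y| = p y := by rcases abs_choice y with h | h <;> rw [h]; exact heven y
  rw [h5] at h4
  nlinarith [abs_pos.2 hy0]

/-! ### Stationarity, uniqueness and continuity of the maximizer. -/

namespace WeightRegularity

variable {w : (N : ℕ) → Fin N → ℝ} {Ω : Type*} [MeasurableSpace Ω] {P : Measure Ω}
  [IsProbabilityMeasure P] {W : Ω → ℝ}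

/-- A positive mean forces `W > 0` with positive probability, so strictness is needed only there. -/
theorem integral_comp_pos (hreg : WeightRegularity w P W) (hw : ∀ N i, 0 < w N i) {g : ℝ → ℝ}
    (h0 : 0 ≤ g 0) (hg : ∀ x, 0 < x → 0 < g x) (hint : Integrable (fun x => g (W x)) P) :
    0 < ∫ x, g (W x) ∂P := by
  have hW := hreg.ae_nonneg hw
  have h1 := (integral_pos_iff_support_of_nonneg_ae hW hreg.integrable).1 hreg.mean_pos
  rw [integral_pos_iff_support_of_nonneg_ae ?_ hint]
  · refine h1.trans_le (measure_mono_ae ?_)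
    filter_upwards [hW] with x hx hx0
    exact (hg _ (lt_of_le_of_ne hx (Ne.symm hx0))).ne'
  · filter_upwards [hW] with x hx
    rcases hx.eq_or_lt with h | h
    · exact h ▸ h0
    · exact (hg _ h).le

theorem integrable_mul_tanh (hreg : WeightRegularity w P W) (u B : ℝ) :
    Integrable (fun x => W x * Real.tanh (u * W x + B)) P :=
  hreg.integrable.mul_bdd (c := 1) (hreg.integrable_affine abs_tanh_sub_le u B).1
    (ae_of_all _ fun _ => (Real.abs_tanh_lt_one _).le)

theorem hasDerivAt_variational (hreg : WeightRegularity w P W) (a z B : ℝ) :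
    HasDerivAt (fun z => variational P W a z B)
      (-(a * (∫ x, W x ∂P) * z) + a * ∫ x, W x * Real.tanh (a * z * W x + B) ∂P) z := by
  refine HasDerivAt.add ?_ ?_
  · have h := (((hasDerivAt_pow 2 z).const_mul (a * ∫ x, W x ∂P)).div_const 2).fun_neg
    exact h.congr_deriv (by norm_num; ring)
  · rw [← integral_const_mul]
    refine (hasDerivAt_integral_of_dominated_loc_of_deriv_le (bound := fun x => |a * W x|)
      (F' := fun z x => a * (W x * Real.tanh (a * z * W x + B))) univ_mem
      (.of_forall fun z => (hreg.integrable_affine abs_logTwoCosh_sub_le _ _).1)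
      (hreg.integrable_affine abs_logTwoCosh_sub_le _ _)
      ((hreg.integrable_mul_tanh _ _).const_mul a).1 (ae_of_all _ fun x y _ => ?_)
      (hreg.integrable.const_mul a).abs (ae_of_all _ fun x y _ => ?_)).2
    · rw [← mul_assoc, Real.norm_eq_abs, abs_mul]
      exact mul_le_of_le_one_right (abs_nonneg _) (Real.abs_tanh_lt_one _).le
    · have h1 : HasDerivAt (fun y => a * y * W x + B) (a * W x) y := by
        simpa using (((hasDerivAt_id y).const_mul a).mul_const (W x)).add_const B
      have h2 := (hasDerivAt_logTwoCosh (a * y * W x + B)).comp y h1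
      exact h2.congr_deriv (by ring)

theorem stationary_of_eq_pressure (hreg : WeightRegularity w P W) (hw : ∀ N i, 0 < w N i)
    {a : ℝ} (ha : 0 < a) {z B : ℝ} (hz : variational P W a z B = pressure P W a B) :
    (∫ x, W x ∂P) * z = ∫ x, W x * Real.tanh (a * z * W x + B) ∂P := by
  have hmax : IsLocalMax (fun z => variational P W a z B) z :=
    .of_forall fun y => (hreg.variational_le_pressure hw ha.le y B).trans_eq hz.symm
  have h := hmax.hasDerivAt_eq_zero (hreg.hasDerivAt_variational a z B)
  refine mul_left_cancel₀ ha.ne' ?_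
  linarith

/-- `z = 0` violates stationarity because `E[W] tanh B > 0`. For `z < 0`, passing to `-z` strictly
increases the absolute field wherever `W > 0`. -/
theorem maximizer_pos (hreg : WeightRegularity w P W) (hw : ∀ N i, 0 < w N i)
    {a : ℝ} (ha : 0 < a) {z B : ℝ} (hB : 0 < B)
    (hz : variational P W a z B = pressure P W a B) : 0 < z := by
  by_contra! hz0
  rcases hz0.eq_or_lt with rfl | hlt
  · have h := hreg.stationary_of_eq_pressure hw ha hz
    simp only [mul_zero, zero_mul, zero_add] at h
    rw [integral_mul_const] at h
    exact (mul_pos hreg.mean_pos (tanh_pos hB)).ne h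
  · have h1 := hreg.variational_le_pressure hw ha.le (-z) B
    rw [← hz, variational, variational, neg_sq] at h1
    have hi1 := hreg.integrable_affine abs_logTwoCosh_sub_le (a * z) B
    have hi2 := hreg.integrable_affine abs_logTwoCosh_sub_le (a * -z) B
    have h2 := hreg.integral_comp_pos hw
      (g := fun x => logTwoCosh (a * -z * x + B) - logTwoCosh (a * z * x + B)) (by simp)
      (fun x hx => sub_pos.2 (logTwoCosh_lt_of_abs_lt ?_)) (hi2.sub hi1)
    · rw [integral_sub hi2 hi1] at h2
      linarith
    · have h3 : 0 < a * -z * x := mul_pos (mul_pos ha (neg_pos.2 hlt)) hx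
      rw [abs_of_pos (a := a * -z * x + B) (by linarith), abs_lt]
      constructor <;> linarith

/-- Cross-multiplying the stationarity equations at `0 < z < z'` gives equal integrals, against the
strict inequality `mul_tanh_affine_lt`. -/
theorem maximizer_unique (hreg : WeightRegularity w P W) (hw : ∀ N i, 0 < w N i)
    {a : ℝ} (ha : 0 < a) {z z' B : ℝ} (hB : 0 < B)
    (hz : variational P W a z B = pressure P W a B)
    (hz' : variational P W a z' B = pressure P W a B) : z = z' := by
  wlog hlt : z < z' generalizing z z'
  · rcases (not_lt.1 hlt).eq_or_lt with h | h
    · exact h.symm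
    · exact (this hz' hz h).symm
  exfalso
  have h0 := hreg.maximizer_pos hw ha hB hz
  have h1 := hreg.stationary_of_eq_pressure hw ha hz
  have h2 := hreg.stationary_of_eq_pressure hw ha hz'
  have hi1 := (hreg.integrable_mul_tanh (a * z) B).const_mul (a * z')
  have hi2 := (hreg.integrable_mul_tanh (a * z') B).const_mul (a * z)
  have h3 := hreg.integral_comp_pos hw
    (g := fun x => a * z' * (x * Real.tanh (a * z * x + B)) -
      a * z * (x * Real.tanh (a * z' * x + B))) (by simp) (fun _ hx => ?_) (hi1.sub hi2)
  · rw [integral_sub hi1 hi2, integral_const_mul, integral_const_mul, ← h1, ← h2] at h3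
    exact h3.ne' (by ring)
  · have h4 := mul_tanh_affine_lt (mul_pos ha h0) (mul_lt_mul_of_pos_left hlt ha) hx.le hB
    have h5 := mul_lt_mul_of_pos_left h4 hx
    linarith

theorem abs_variational_sub_le (hreg : WeightRegularity w P W) (hw : ∀ N i, 0 < w N i)
    (a z B B' : ℝ) : |variational P W a z B - variational P W a z B'| ≤ |B - B'| := by
  have h := hreg.abs_integral_affine_sub_le hw abs_logTwoCosh_sub_le (a * z) (a * z) B B'
  rwa [sub_self, abs_zero, zero_mul, zero_add, ← add_sub_add_left_eq_sub] at h

/-- By uniqueness and compactness, values outside a ball around `ζ B` stay a fixed gap below the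
maximum. Moving `B` by less than half the gap cannot bring the maximizer out of the ball. -/
theorem continuousAt_maximizer (hreg : WeightRegularity w P W) (hw : ∀ N i, 0 < w N i)
    {a : ℝ} (ha : 0 < a) {ζ : ℝ → ℝ} (hζ : ∀ B, ζ B ∈ Set.Icc (-1 : ℝ) 1)
    (hmax : ∀ B, variational P W a (ζ B) B = pressure P W a B) {B : ℝ} (hB : 0 < B) :
    ContinuousAt ζ B := by
  refine Metric.tendsto_nhds.2 fun ε hε => ?_
  have hK : IsCompact (Set.Icc (-1 : ℝ) 1 \ Metric.ball (ζ B) ε) :=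
    isCompact_Icc.diff Metric.isOpen_ball
  rcases Set.eq_empty_or_nonempty (Set.Icc (-1 : ℝ) 1 \ Metric.ball (ζ B) ε) with hne | hne
  · exact .of_forall fun B' => Set.sdiff_eq_empty.1 hne (hζ B')
  obtain ⟨z, hz, hzmax⟩ := hK.exists_isMaxOn hne
    (hreg.continuous_variational hw a B).continuousOn
  have hδ : variational P W a z B < pressure P W a B := by
    refine lt_of_le_of_ne (hreg.variational_le_pressure hw ha.le z B) fun h => hz.2 ?_
    rw [hreg.maximizer_unique hw ha hB h (hmax B)]
    exact Metric.mem_ball_self hε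
  filter_upwards [Metric.ball_mem_nhds B
    (half_pos (sub_pos.2 hδ))] with B' hB'
  by_contra hfar
  have h1 : variational P W a (ζ B') B ≤ variational P W a z B := hzmax ⟨hζ B', hfar⟩
  have h2 := (abs_le.1 (hreg.abs_variational_sub_le hw a (ζ B') B' B)).2
  have h3 := (abs_le.1 (hreg.abs_variational_sub_le hw a (ζ B) B' B)).1
  have h4 := hreg.variational_le_pressure hw ha.le (ζ B) B'
  rw [hmax] at h2 h3
  rw [Metric.mem_ball, Real.dist_eq] at hB'
  linarith

/-- Freeze the maximizer at `B`, vary the field, and use the tangent line of `logTwoCosh`: the slope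
is the mean of `tanh`. -/
theorem exists_subgradient (hreg : WeightRegularity w P W) (hw : ∀ N i, 0 < w N i)
    {a : ℝ} (ha : 0 ≤ a) :
    ∃ D : ℝ → ℝ, (∀ B B', pressure P W a B + D B * (B' - B) ≤ pressure P W a B') ∧
      ∀ B, 0 < B → ContinuousAt D B := by
  choose ζ hζ hmax using hreg.exists_variational_eq_pressure hw a
  refine ⟨fun B => ∫ x, Real.tanh (a * ζ B * W x + B) ∂P, fun B B' => ?_, fun B hB => ?_⟩
  · refine le_trans ?_ (hreg.variational_le_pressure hw ha (ζ B) B')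
    rw [← hmax B, variational, variational, add_assoc, ← integral_mul_const]
    have hi1 := hreg.integrable_affine abs_logTwoCosh_sub_le (a * ζ B) B
    have hi2 := (hreg.integrable_affine abs_tanh_sub_le (a * ζ B) B).mul_const (B' - B)
    rw [← integral_add hi1 hi2]
    refine add_le_add_right (integral_mono (hi1.add hi2)
      (hreg.integrable_affine abs_logTwoCosh_sub_le (a * ζ B) B') fun x => ?_) _
    have h := logTwoCosh_add_tanh_mul_le (a * ζ B * W x + B) (a * ζ B * W x + B')
    rwa [add_sub_add_left_eq_sub] at h
  · have hc : ContinuousAt (fun B => a * ζ B) B := by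
      -- For `a = 0` the selection `ζ` is arbitrary, but only the product `a * ζ B` enters.
      rcases ha.eq_or_lt with rfl | ha
      · simpa using continuousAt_const
      · exact continuousAt_const.mul (hreg.continuousAt_maximizer hw ha hζ hmax hB)
    have hlim : Tendsto (fun B' => |a * ζ B' - a * ζ B| * (∫ x, W x ∂P) + |B' - B|)
        (𝓝 B) (𝓝 0) := by
      have h1 : ContinuousAt
          (fun B' => |a * ζ B' - a * ζ B| * (∫ x, W x ∂P) + |B' - B|) B := by
        fun_prop
      simpa [ContinuousAt] using h1
    rw [ContinuousAt, tendsto_iff_dist_tendsto_zero]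
    exact squeeze_zero (fun _ => dist_nonneg)
      (fun B' => hreg.abs_integral_affine_sub_le hw abs_tanh_sub_le _ _ _ _) hlim

theorem pressure_neg (hreg : WeightRegularity w P W) (hw : ∀ N i, 0 < w N i)
    {a : ℝ} (ha : 0 ≤ a) (B : ℝ) : pressure P W a (-B) = pressure P W a B := by
  have h : ∀ B, pressure P W a (-B) ≤ pressure P W a B := fun B => by
    obtain ⟨z, -, hz⟩ := hreg.exists_variational_eq_pressure hw a (-B)
    rw [← hz]
    refine le_of_eq_of_le ?_ (hreg.variational_le_pressure hw ha (-z) B)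
    rw [variational, variational, neg_sq]
    congr 2
    funext x
    rw [← logTwoCosh_neg]
    congr 1
    ring
  exact le_antisymm (h B) (by simpa using h (-B))

end WeightRegularity

/-! ### Exponential concentration -/

open Classical in
-- Exponential tilting by `t` is a shift of the field; the sign of `t` selects the tail.
theorem chernoff_cwWeight {N : ℕ} (w : Fin N → ℝ) (a B t x : ℝ) :
    ∑ σ : SpinConfig N with t * x ≤ t * totalSpin σ, cwWeight w a B σ ≤
      Real.exp (-(t * x)) * cwPartition w a (B + t) := by
  rw [cwPartition, Finset.mul_sum, Finset.sum_filter]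
  refine Finset.sum_le_sum fun σ _ => ?_
  split_ifs with h
  · rw [cwWeight, cwWeight, ← Real.exp_add]
    exact Real.exp_le_exp.2 (by linarith)
  · exact (mul_pos (Real.exp_pos _) (Real.exp_pos _)).le

/-- Exponential concentration of the total spin per vertex around `M`. -/
def ConcentratesAt (w : (N : ℕ) → Fin N → ℝ) (β B M : ℝ) : Prop :=
  ∀ ε : ℝ, 0 < ε → ∃ L : ℝ, 0 < L ∧ ∀ᶠ N : ℕ in atTop,
    (annealedMeasure (w N) β B).real {σ | ε ≤ |totalSpin σ / (N : ℝ) - M|} ≤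
      Real.exp (-((N : ℝ) * L))

theorem abs_annealedMagnetization_sub_le {N : ℕ} (w : Fin N → ℝ) (β B M : ℝ) {ε : ℝ}
    (hε : 0 < ε) : |annealedMagnetization w β B - M| ≤
      ε + (1 + |M|) * (annealedMeasure w β B).real {σ | ε ≤ |totalSpin σ / (N : ℝ) - M|} := by
  classical
  have h1 : annealedMagnetization w β B - M =
      ∑ σ, annealedProb w β B σ * (totalSpin σ / N - M) := by
    simp_rw [mul_sub]
    rw [Finset.sum_sub_distrib, ← Finset.sum_mul, sum_annealedProb, one_mul,
      annealedMagnetization, integral_annealedMeasure]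
  have h2 : ε + (1 + |M|) * (annealedMeasure w β B).real {σ | ε ≤ |totalSpin σ / (N : ℝ) - M|} =
      ∑ σ, annealedProb w β B σ *
        (ε + if ε ≤ |totalSpin σ / (N : ℝ) - M| then 1 + |M| else 0) := by
    simp_rw [mul_add]
    rw [Finset.sum_add_distrib, ← Finset.sum_mul, sum_annealedProb, one_mul,
      annealedMeasure_real, Finset.sum_filter, Finset.mul_sum]
    congr 1
    refine Finset.sum_congr rfl fun σ _ => ?_
    simp only [Set.mem_ofPred_eq]
    split_ifs <;> ring
  rw [h1, h2]
  refine (Finset.abs_sum_le_sum_abs _ _).trans (Finset.sum_le_sum fun σ _ => ?_)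
  rw [abs_mul, abs_of_nonneg (annealedProb_nonneg w β B σ)]
  refine mul_le_mul_of_nonneg_left ?_ (annealedProb_nonneg w β B σ)
  split_ifs with h
  · have h3 : |totalSpin σ / (N : ℝ)| ≤ 1 := by
      rw [abs_div, Nat.abs_cast]
      exact div_le_one_of_le₀ (abs_totalSpin_le σ) (Nat.cast_nonneg N)
    have h4 := abs_sub (totalSpin σ / (N : ℝ)) M
    linarith
  · linarith [not_le.1 h]

theorem ConcentratesAt.isLimitMagnetization {w : (N : ℕ) → Fin N → ℝ} {β B M : ℝ}
    (h : ConcentratesAt w β B M) : IsLimitMagnetization w β B M := by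
  refine Metric.tendsto_nhds.2 fun ε hε => ?_
  obtain ⟨L, hL, hN⟩ := h (ε / 2) (half_pos hε)
  have h1 : Tendsto (fun N : ℕ => (1 + |M|) * Real.exp (-((N : ℝ) * L))) atTop (𝓝 0) := by
    have h2 : Tendsto (fun N : ℕ => Real.exp (-((N : ℝ) * L))) atTop (𝓝 0) :=
      Real.tendsto_exp_neg_atTop_nhds_zero.comp
        (tendsto_natCast_atTop_atTop.atTop_mul_const hL)
    simpa using h2.const_mul (1 + |M|)
  filter_upwards [hN, h1.eventually (gt_mem_nhds (half_pos hε))] with N h2 h3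
  have h4 := abs_annealedMagnetization_sub_le (w N) β B M (half_pos hε)
  have h5 := mul_le_mul_of_nonneg_left h2 (by positivity : 0 ≤ 1 + |M|)
  rw [Real.dist_eq]
  linarith

namespace WeightRegularity

variable {w : (N : ℕ) → Fin N → ℝ} {Ω : Type*} [MeasurableSpace Ω] {P : Measure Ω}
  [IsProbabilityMeasure P] {W : Ω → ℝ}

open Classical in
/-- One-sided Chernoff bound; `s = 1` gives the upper tail and `s = -1` the lower tail. -/
theorem exists_tail_bound (hreg : WeightRegularity w P W) (hw : ∀ N i, 0 < w N i)
    {a B M : ℝ} (ha : 0 ≤ a) (hM : HasDerivAt (pressure P W a) M B) {ε : ℝ} (hε : 0 < ε)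
    {s : ℝ} (hs : s * s = 1) :
    ∃ L : ℝ, 0 < L ∧ ∀ᶠ N : ℕ in atTop,
      ∑ σ : SpinConfig N with s * (N * (M + s * ε)) ≤ s * totalSpin σ,
        cwWeight (w N) a B σ / cwPartition (w N) a B ≤ Real.exp (-((N : ℝ) * L)) := by
  -- Tilting by `sτ` gains `τε` per vertex, and differentiability keeps the loss below `τε/2`. The
  -- net exponent `-τε/2` leaves room for the rate `τε/4`.
  obtain ⟨τ, hτ, hbound⟩ : ∃ τ : ℝ, 0 < τ ∧
      pressure P W a (B + s * τ) - pressure P W a B - s * τ * M ≤ ε / 2 * τ := by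
    have h := (hasDerivAt_iff_isLittleO.1 hM).def (half_pos hε)
    have h1 : Tendsto (fun τ : ℝ => B + s * τ) (𝓝[>] 0) (𝓝 B) :=
      (Continuous.tendsto' (by fun_prop) 0 B (by simp)).mono_left nhdsWithin_le_nhds
    obtain ⟨τ, h2, h3⟩ := ((h1.eventually h).and self_mem_nhdsWithin).exists
    have h3 : 0 < τ := h3
    have hs' : |s| = 1 := by
      rw [← sq_eq_sq₀ (abs_nonneg s) zero_le_one, sq_abs, sq, hs, one_pow]
    rw [add_sub_cancel_left, smul_eq_mul, Real.norm_eq_abs, Real.norm_eq_abs, abs_mul, hs',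
      one_mul, abs_of_pos h3] at h2
    exact ⟨τ, h3, (le_abs_self _).trans h2⟩
  refine ⟨τ * ε / 4, by positivity, ?_⟩
  have hlim := ((hreg.tendsto_log_cwPartition hw ha (B + s * τ)).sub
    (hreg.tendsto_log_cwPartition hw ha B)).sub_const (s * τ * (M + s * ε))
  have hneg : pressure P W a (B + s * τ) - pressure P W a B - s * τ * (M + s * ε) <
      -(τ * ε / 4) := by
    have h1 : s * τ * (M + s * ε) = s * τ * M + s * s * (τ * ε) := by ring
    rw [h1, hs]
    nlinarith [mul_pos hτ hε]
  filter_upwards [hlim.eventually (gt_mem_nhds hneg), eventually_gt_atTop 0] with N h1 h2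
  have hN : (0 : ℝ) < N := Nat.cast_pos.2 h2
  have hZ := cwPartition_pos (w N) a B
  have hZ' := cwPartition_pos (w N) a (B + s * τ)
  rw [← Finset.sum_div, div_le_iff₀ hZ]
  have h3 : ∀ σ : SpinConfig N, s * (N * (M + s * ε)) ≤ s * totalSpin σ ↔
      s * τ * (N * (M + s * ε)) ≤ s * τ * totalSpin σ := fun σ => by
    rw [mul_right_comm s τ, mul_right_comm s τ, mul_le_mul_iff_left₀ hτ]
  simp_rw [h3]
  refine (chernoff_cwWeight (w N) a B (s * τ) (N * (M + s * ε))).trans ?_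
  rw [← Real.exp_log hZ, ← Real.exp_log hZ', ← Real.exp_add, ← Real.exp_add, Real.exp_le_exp]
  rw [← sub_div, div_sub' hN.ne', div_lt_iff₀ hN] at h1
  linarith

theorem concentratesAt_of_hasDerivAt (hreg : WeightRegularity w P W) (hw : ∀ N i, 0 < w N i)
    {β B M : ℝ} (hβ : 0 ≤ β) (hM : HasDerivAt (pressure P W (Real.sinh β)) M B) :
    ConcentratesAt w β B M := by
  classical
  intro ε hε
  have ha : 0 ≤ Real.sinh β := Real.sinh_nonneg_iff.2 hβ
  obtain ⟨L₁, hL₁, h1⟩ := hreg.exists_tail_bound hw ha hM hε (s := 1) (by norm_num)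
  obtain ⟨L₂, hL₂, h2⟩ := hreg.exists_tail_bound hw ha hM hε (s := -1) (by norm_num)
  set L := min L₁ L₂
  have hL : 0 < L := lt_min hL₁ hL₂
  have hconst : Tendsto (fun N : ℕ =>
      Real.exp (2 * β) * ((∑ i, w N i ^ 2) / totalWeight (w N)) ^ 2) atTop
      (𝓝 (Real.exp (2 * β) * ((∫ x, W x ^ 2 ∂P) / ∫ x, W x ∂P) ^ 2)) := by
    refine (((hreg.tendsto_mean_sq.div hreg.tendsto_mean hreg.mean_pos.ne').pow 2).const_mul
      _).congr' ?_
    filter_upwards [eventually_gt_atTop 0] with N hN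
    have hN' : (1 / (N : ℝ)) ≠ 0 := by positivity
    rw [Pi.div_apply, mul_div_mul_left _ _ hN', totalWeight]
  set c := Real.exp (2 * β) * ((∫ x, W x ^ 2 ∂P) / ∫ x, W x ∂P) ^ 2
  have hlarge : ∀ᶠ N : ℕ in atTop, c + 1 + Real.log 2 ≤ (N : ℝ) * (L / 2) :=
    (tendsto_natCast_atTop_atTop.atTop_mul_const (half_pos hL)).eventually_ge_atTop _
  -- Half of the rate absorbs the comparison factor and the two tails of the union bound.
  refine ⟨L / 2, half_pos hL, ?_⟩
  filter_upwards [h1, h2, hconst.eventually (gt_mem_nhds (lt_add_one c)), hlarge,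
    eventually_gt_atTop 0] with N h3 h4 h5 h6 h7
  have hN : (0 : ℝ) < N := Nat.cast_pos.2 h7
  set c' := Real.exp (2 * β) * ((∑ i, w N i ^ 2) / totalWeight (w N)) ^ 2
  let q : SpinConfig N → ℝ := fun σ =>
    cwWeight (w N) (Real.sinh β) B σ / cwPartition (w N) (Real.sinh β) B
  have hq : ∀ σ, 0 ≤ q σ := fun σ => (div_pos (Real.exp_pos _) (cwPartition_pos _ _ _)).le
  have hcover : ∑ σ with σ ∈ {σ : SpinConfig N | ε ≤ |totalSpin σ / (N : ℝ) - M|}, q σ ≤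
      ∑ σ : SpinConfig N with 1 * (N * (M + 1 * ε)) ≤ 1 * totalSpin σ, q σ +
      ∑ σ : SpinConfig N with -1 * (N * (M + -1 * ε)) ≤ -1 * totalSpin σ, q σ := by
    rw [Finset.sum_filter, Finset.sum_filter, Finset.sum_filter, ← Finset.sum_add_distrib]
    refine Finset.sum_le_sum fun σ _ => ?_
    have h8 := hq σ
    by_cases hσ : σ ∈ {σ : SpinConfig N | ε ≤ |totalSpin σ / (N : ℝ) - M|}
    · have h9 : 1 * (N * (M + 1 * ε)) ≤ 1 * totalSpin σ ∨
          -1 * (N * (M + -1 * ε)) ≤ -1 * totalSpin σ := by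
        have hσ : ε ≤ |totalSpin σ / (N : ℝ) - M| := hσ
        rcases le_abs.1 hσ with h | h
        · left
          rw [le_sub_iff_add_le, le_div_iff₀ hN] at h
          linarith
        · right
          have h10 : totalSpin σ / (N : ℝ) ≤ M - ε := by linarith
          rw [div_le_iff₀ hN] at h10
          linarith
      rw [if_pos hσ]
      rcases h9 with h9 | h9
      · rw [if_pos h9]
        split_ifs <;> linarith
      · rw [if_pos h9]
        split_ifs <;> linarith
    · rw [if_neg hσ]
      positivity
  have hmin : ∀ {L' : ℝ}, L ≤ L' → Real.exp (-((N : ℝ) * L')) ≤ Real.exp (-((N : ℝ) * L)) :=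
    fun h => Real.exp_le_exp.2 (neg_le_neg (mul_le_mul_of_nonneg_left h hN.le))
  calc (annealedMeasure (w N) β B).real {σ | ε ≤ |totalSpin σ / (N : ℝ) - M|}
      ≤ ∑ σ with σ ∈ {σ : SpinConfig N | ε ≤ |totalSpin σ / (N : ℝ) - M|},
          Real.exp c' * q σ := by
        rw [annealedMeasure_real]
        exact Finset.sum_le_sum fun σ _ => annealedProb_le (hw N) hβ B σ
    _ ≤ Real.exp c' * (2 * Real.exp (-((N : ℝ) * L))) := by
        rw [← Finset.mul_sum]
        refine mul_le_mul_of_nonneg_left ?_ (Real.exp_pos _).le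
        linarith [h3.trans (hmin (min_le_left _ _)), h4.trans (hmin (min_le_right _ _))]
    _ = Real.exp (c' + (Real.log 2 + -((N : ℝ) * L))) := by
        rw [Real.exp_add, Real.exp_add, Real.exp_log two_pos]
    _ ≤ Real.exp (-((N : ℝ) * (L / 2))) := Real.exp_le_exp.2 (by linarith)

theorem exists_hasDerivAt_pressure (hreg : WeightRegularity w P W) (hw : ∀ N i, 0 < w N i)
    {β B : ℝ} (hβB : (β, B) ∈ uniquenessRegime w) :
    0 ≤ β ∧ ∃ M : ℝ, HasDerivAt (pressure P W (Real.sinh β)) M B := by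
  have hβ : 0 ≤ β := by
    rcases hβB with h | h
    exacts [h.1, h.1.le]
  refine ⟨hβ, ?_⟩
  have ha : 0 ≤ Real.sinh β := Real.sinh_nonneg_iff.2 hβ
  obtain ⟨D, hsub, hcont⟩ := hreg.exists_subgradient hw ha
  have heven := hreg.pressure_neg hw ha
  have hpos : ∀ B, 0 < B → HasDerivAt (pressure P W (Real.sinh β)) (D B) B :=
    fun B hB => hasDerivAt_of_subgradient hsub (hcont B hB)
  rcases hβB with ⟨-, hB⟩ | ⟨hβ0, hβc, hB⟩
  · rcases lt_or_gt_of_ne hB with h | h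
    · have h1 := (hpos (-B) (neg_pos.2 h)).scomp B (hasDerivAt_neg B)
      exact ⟨_, h1.congr_of_eventuallyEq (.of_forall fun x => (heven x).symm)⟩
    · exact ⟨_, hpos B h⟩
  · obtain rfl : B = 0 := hB
    have hD0 : ∀ B ∈ Set.Ioi (0 : ℝ), 0 ≤ D B := fun B hB => by
      have h1 := hsub B (-B)
      rw [heven] at h1
      have hB : 0 < B := hB
      nlinarith
    have hlim := (monotone_of_subgradient hsub).tendsto_nhdsGT 0
    set m := sInf (D '' Set.Ioi 0)
    have hm : 0 ≤ m := ge_of_tendsto hlim (eventually_nhdsWithin_of_forall hD0)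
    -- Concentration at `B > 0` already identifies `D B` as the limiting magnetization; monotonicity
    -- of `D` supplies the right limit. A positive `m` would put `β` in the set whose infimum is the
    -- critical point.
    have hspont : IsSpontaneousMagnetization w β m := ⟨D, fun B hB =>
      (hreg.concentratesAt_of_hasDerivAt hw hβ (hpos B hB)).isLimitMagnetization, hlim⟩
    rcases hm.eq_or_lt with h | h
    · rw [← h] at hlim
      exact ⟨0, hasDerivAt_zero_of_subgradient_tendsto hsub heven hlim⟩
    · have hle : criticalInverseTemperature w ≤ (β : EReal) :=
        sInf_le ⟨β, rfl, hβ0, m, h, hspont⟩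
      exact absurd hle hβc.not_ge

end WeightRegularity

end

end AnnealedIsing

theorem mainTheorem7 {Ω : Type*} [MeasurableSpace Ω] (P : Measure Ω) [IsProbabilityMeasure P]
    (W : Ω → ℝ) (w : (N : ℕ) → Fin N → ℝ) (hw : ∀ N i, 0 < w N i)
    (hreg : AnnealedIsing.WeightRegularity w P W) (β B : ℝ)
    (hβB : (β, B) ∈ AnnealedIsing.uniquenessRegime w) :
    ∃ M : ℝ, AnnealedIsing.IsLimitMagnetization w β B M ∧
      ∀ ε : ℝ, 0 < ε → ∃ L : ℝ, 0 < L ∧ ∀ᶠ N : ℕ in atTop,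
        (AnnealedIsing.annealedMeasure (w N) β B).real
            {σ | ε ≤ |AnnealedIsing.totalSpin σ / (N : ℝ) - M|}
          ≤ Real.exp (-((N : ℝ) * L)) := by
  obtain ⟨hβ, M, hM⟩ := hreg.exists_hasDerivAt_pressure hw hβB
  have h := hreg.concentratesAt_of_hasDerivAt hw hβ hM
  exact ⟨M, h.isLimitMagnetization, h⟩
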